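/- Let $q\ge 4$ be a prime power. A $q$-ary linear code $\mathcal C\subseteq\mathbb F_q^n$ of dimension $k$ and minimum distance $d$ is an LRC with parameters $(n,k,d,r)_q$ if every coordinate $i\in[n]$ has a set $R_i\subseteq[n]\setminus\{i\}$ with $|R_i|\le r$ and fixed nonzero coefficients $\kappa_j\in\mathbb F_q$ $(j\in R_i)$ such that $c_i=\sum_{j\in R_i}\kappa_jc_j$ for all $c\in\mathcal C$; the sets $R_i\cup\{i\}$ are its local repair groups. It has disjoint local repair groups if some local repair groups of cardinality $r+1$ partition $[n]$, and it is almost optimal if $d=n-k-\lceil k/r\rceil+1$. A $2$-spread of $\mathbb F_q^4$ is a set of $2$-dimensional subspaces which pairwise intersect in $\{0\}$ and whose union is $\mathbb F_q^4$. For a subspace $W$ let ${W\brack 1}$ be the set of its one-dimensional subspaces. Consider the following algorithm. Start with a $2$-spread $\mathcal P$ of $\mathbb F_q^4$ (one exists, with $q^2+1$ members) and the family $\mathcal M=\{{P\brack 1}:P\in\mathcal P\}$. In round $i=1,2,\dots$ choose arbitrarily a set $A\in\mathcal M$ and three distinct elements of $A$, choose bases $u_0^{(i)},u_1^{(i)},u_2^{(i)}$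 of these with $u_0^{(i)}=u_1^{(i)}-u_2^{(i)}$, and remove $A$ from $\mathcal M$; then, if $i\ge 2$, replace every remaining $B\in\mathcal M$ by $B\setminus\bigcup_{j<i}\bigcup_{a,b\in\{0,1,2\}}{\mathrm{span}\{u_a^{(i)},u_b^{(j)}\}\brack 1}$ and drop from $\mathcal M$ those which now have fewer than three elements. When $\mathcal M=\varnothing$ after a round, stop, put $L=i$, and output $(u_1^{(1)},u_2^{(1)}),\dots,(u_1^{(L)},u_2^{(L)})$. **Theorem.** The choices required by the algorithm are always possible, and, whatever choices are made, it stops after at most $q^2+1$ rounds. Every output satisfies $L\ge\max\{\lceil\frac{\sqrt2}{3}q\rceil,3\}$. The code whose parity-check matrix is the $(L+4)\times 3L$ matrix with columns $$\binom{e_i}{u_1^{(i)}},\ \binom{e_i}{u_2^{(i)}},\ \binom{e_i}{0}\qquad(i=1,\dots,L),$$ where $e_i$ is the $i$-th unit vector of $\mathbb F_q^L$, is an LRC with disjoint local repair groups and parameters $(n=3L,\ k=2L-4,\ d,\ r=2)_q$ with $d\in\{7,8\}$, and it attains with equality the bound $$k\le\frac{rn}{r+1}-\Big\lceil\log_q\Big(q+(q-1)q\Big(\frac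 r2n-r\Big)\Big)\Big\rceil .$$ If moreover $n>q+4$, then $d=7$, the code is almost optimal, and every LRC over $\mathbb F_q$ with parameters $(n,k,d',2)_q$ (with disjoint local repair groups or not) has $d'\le 7$. -/

import Mathlib

namespace SpreadLRC

/-! ### Linear codes and locally repairable codes -/

section Codes

variable {F : Type*} [Field F] {ι : Type*} [Fintype ι]

/-- `d` is the minimum distance of the linear code `C`: the least Hamming distance between two
distinct codewords. -/
def IsMinDist [DecidableEq F] (C : Submodule F (ι → F)) (d : ℕ) : Prop :=
  IsLeast {w : ℕ | ∃ x ∈ C, ∃ y ∈ C, x ≠ y ∧ hammingDist x y = w} d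

/-- `R` is a repair set of the coordinate `i`: `i ∉ R`, and there are fixed nonzero coefficients
`κ j` (`j ∈ R`) such that `c i = ∑ j ∈ R, κ j * c j` for every codeword `c`. -/
def IsRepairSet (C : Submodule F (ι → F)) (i : ι) (R : Finset ι) : Prop :=
  i ∉ R ∧ ∃ κ : ι → F, (∀ j ∈ R, κ j ≠ 0) ∧ ∀ c ∈ C, c i = ∑ j ∈ R, κ j * c j

/-- `C` is a locally repairable code with parameters `(n, k, d, r)_q`, `q = |F|`: length `n`,
dimension `k`, minimum distance `d`, and every coordinate has a repair set of size at most `r`. -/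
structure IsLRC [DecidableEq F] (C : Submodule F (ι → F)) (n k d r : ℕ) : Prop where
  length_eq : Fintype.card ι = n
  dim_eq : Module.finrank F C = k
  minDist : IsMinDist C d
  locality : ∀ i : ι, ∃ R : Finset ι, IsRepairSet C i R ∧ R.card ≤ r

/-- `G` is a local repair group: `G = R ∪ {i}` for a repair set `R` of `i` with `|R| ≤ r`. -/
def IsLocalRepairGroup [DecidableEq ι] (C : Submodule F (ι → F)) (r : ℕ) (G : Finset ι) : Prop :=
  ∃ (i : ι) (R : Finset ι), IsRepairSet C i R ∧ R.card ≤ r ∧ G = insert i R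

/-- `C` has disjoint local repair groups: some local repair groups, each of cardinality `r + 1`,
form a partition of the set of coordinates. -/
def HasDisjointRepairGroups [DecidableEq ι] (C : Submodule F (ι → F)) (r : ℕ) : Prop :=
  ∃ 𝒢 : Finpartition (Finset.univ : Finset ι),
    ∀ G ∈ 𝒢.parts, IsLocalRepairGroup C r G ∧ G.card = r + 1

end Codes

/-- The right-hand side of the dimension bound
`k ≤ rn/(r+1) - ⌈log_q (q + (q-1) q (rn/2 - r))⌉`. -/
noncomputable def dimensionBound (q n r : ℕ) : ℝ :=
  (r : ℝ) * n / (r + 1) -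
    (⌈Real.logb q ((q : ℝ) + ((q : ℝ) - 1) * q * ((r : ℝ) / 2 * n - r))⌉ : ℤ)

/-- The parameters of an almost optimal LRC: `d = n - k - ⌈k / r⌉ + 1`. -/
def AlmostOptimal (n k d r : ℕ) : Prop :=
  (d : ℤ) = (n : ℤ) - k - ⌈(k : ℚ) / r⌉ + 1

/-! ### Spreads -/

section Spreads

variable {F V : Type*} [Field F] [AddCommGroup V] [Module F V]

/-- A `t`-spread of `V`: a set of `t`-dimensional subspaces of `V` which pairwise intersect
trivially and whose union is `V`. -/
structure IsSpread (t : ℕ) (P : Set (Submodule F V)) : Prop where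
  finrank_eq : ∀ W ∈ P, Module.finrank F W = t
  inter_eq_bot : ∀ W ∈ P, ∀ W' ∈ P, W ≠ W' → W ⊓ W' = ⊥
  covers : ∀ v : V, ∃ W ∈ P, v ∈ W

/-- The set of all one-dimensional subspaces of `W`. -/
def points (W : Submodule F V) : Set (Submodule F V) :=
  {l | l ≤ W ∧ Module.finrank F l = 1}

end Spreads

/-! ### The algorithm -/

section Algorithm

variable {F : Type*} [Field F]

/-- For a pair `p = (u₁, u₂)` the vectors `u₀ = u₁ - u₂`, `u₁`, `u₂`. -/
def triple (p : (Fin 4 → F) × (Fin 4 → F)) : Fin 3 → (Fin 4 → F) :=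
  ![p.1 - p.2, p.1, p.2]

/-- The state of the algorithm at the end of a round: the current set family `𝓜`, and the pairs
`(u₁⁽¹⁾, u₂⁽¹⁾), …, (u₁⁽ⁱ⁾, u₂⁽ⁱ⁾)` found so far, in this order. -/
structure State (F : Type*) [Field F] where
  family : Set (Set (Submodule F (Fin 4 → F)))
  chosen : List ((Fin 4 → F) × (Fin 4 → F))

/-- Initialization: the family of the point sets of the members of the spread `P`. -/
def initial (P : Set (Submodule F (Fin 4 → F))) : State F where
  family := points '' P
  chosen := []

/-- The points that are deleted after the pair `p` has been found, `prev` being the earlier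
pairs: those lying in `span {u_a, u_b'}` for some `a, b ∈ {0, 1, 2}` and some earlier pair. -/
def forbidden (prev : List ((Fin 4 → F) × (Fin 4 → F))) (p : (Fin 4 → F) × (Fin 4 → F)) :
    Set (Submodule F (Fin 4 → F)) :=
  ⋃ p' ∈ prev, ⋃ a : Fin 3, ⋃ b : Fin 3, points (Submodule.span F {triple p a, triple p' b})

/-- The family after the trimming step: the forbidden points are deleted from each member, and
members left with fewer than three points are dropped. There is no trimming in the first round. -/
def trim (M : Set (Set (Submodule F (Fin 4 → F))))
    (prev : List ((Fin 4 → F) × (Fin 4 → F))) (p : (Fin 4 → F) × (Fin 4 → F)) :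
    Set (Set (Submodule F (Fin 4 → F))) :=
  {B' | (prev = [] ∧ B' ∈ M) ∨
    (prev ≠ [] ∧ 3 ≤ B'.ncard ∧ ∃ B ∈ M, B' = B \ forbidden prev p)}

/-- The vectors `u₀ = u₁ - u₂`, `u₁`, `u₂` attached to `p = (u₁, u₂)` are bases of the
one-dimensional subspaces `l 0`, `l 1`, `l 2`. -/
def AreBases (l : Fin 3 → Submodule F (Fin 4 → F)) (p : (Fin 4 → F) × (Fin 4 → F)) : Prop :=
  ∀ a : Fin 3, Submodule.span F {triple p a} = l a

/-- One round: choose any member `A` of the family, any three distinct elements of `A` and any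
bases `u₀ = u₁ - u₂`, `u₁`, `u₂` of them; remove `A` from the family; trim. -/
def Round (s s' : State F) : Prop :=
  ∃ A ∈ s.family, ∃ l : Fin 3 → Submodule F (Fin 4 → F),
    Function.Injective l ∧ (∀ a, l a ∈ A) ∧
    ∃ p : (Fin 4 → F) × (Fin 4 → F), AreBases l p ∧
      s' = ⟨trim (s.family \ {A}) s.chosen p, s.chosen ++ [p]⟩

/-- `s` is reached after finitely many rounds in some run that starts from the spread `P`. -/
def Reachable (P : Set (Submodule F (Fin 4 → F))) (s : State F) : Prop :=
  Relation.ReflTransGen Round (initial P) s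

/-- `U` is an output of a run that starts from the spread `P`: the pairs found when the family
has become empty. -/
def IsOutput (P : Set (Submodule F (Fin 4 → F))) (U : List ((Fin 4 → F) × (Fin 4 → F))) : Prop :=
  Reachable P ⟨∅, U⟩

/-- The `(L + 4) × 3L` parity-check matrix built from `L` pairs. The column `(i, a)` is the
`i`-th unit vector of `F ^ L` on top of `u₁⁽ⁱ⁾`, `u₂⁽ⁱ⁾`, `0` for the three values of `a`. -/
def parityCheck (U : List ((Fin 4 → F) × (Fin 4 → F))) :
    Matrix (Fin U.length ⊕ Fin 4) (Fin U.length × Fin 3) F :=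
  Matrix.fromRows
    (Matrix.of fun i c => if c.1 = i then 1 else 0)
    (Matrix.of fun m c => ![(U.get c.1).1, (U.get c.1).2, 0] c.2 m)

/-- The code with parity-check matrix `parityCheck U`. -/
def code (U : List ((Fin 4 → F) × (Fin 4 → F))) : Submodule F (Fin U.length × Fin 3 → F) :=
  LinearMap.ker (parityCheck U).mulVecLin

end Algorithm

end SpreadLRC

open SpreadLRC

/-!
The algorithm keeps a spread of `F ^ 4` and chooses from different members (lines of the
projective space `PG(3, q)`) three points `u₀ = u₁ - u₂`, `u₁`, `u₂`. The points deleted along the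
way are exactly those that would be collinear with two points chosen earlier in different rounds
(`reachable_invariant`, `IsChoice`), so no three chosen points from different rounds are collinear
(`IsChoice.add_add_ne_zero`).

A line joining two points chosen in different rounds has `q - 1` further points. As a spread member
has `q + 1` points, each of the `q ^ 2 + 1 - L` unused members has lost at least `q - 1` points when
the algorithm stops, whence `(q ^ 2 + 1 - L) (q - 1) ≤ 9 (q - 1) L (L - 1) / 2`
(`IsChoice.length_bound`); this yields the lower bound for `L` and `3 L > q + 3`. Conversely, the
projection from a chosen point is injective on the points chosen in other rounds, so
`3 L ≤ q ^ 2 + q + 3` (`IsChoice.length_upper`). The two bounds on `L` say that the logarithm in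
the dimension bound rounds up to `4`.

A codeword amounts to vectors `vᵢ`, one in each used spread member, with sum zero. The `i`-th group
has weight `0` if `vᵢ = 0`, weight `2` if `vᵢ` lies on one of the three chosen points, and weight
`3` otherwise. At least three `vᵢ` are nonzero, and by the absence of collinear chosen points three
nonzero ones do not all have weight two: the distance is at least `7`
(`IsChoice.seven_le_hammingNorm`). As two members of the spread span `F ^ 4`, a chosen point of a
third one is a sum of vectors in them, which gives a word of weight at most `8`.

For an arbitrary code with these parameters and distance at least `8`, any set of coordinates that
carries too many independent parity checks leads to a word of weight at most `7`
(`Captures.exists_codeword`). Choosing local checks greedily, this forces the local groups to be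
disjoint triples, provided that `L ≥ 4`. Modulo the words supported on one fixed group, the
codewords then have codimension two in the space of the words satisfying all local checks, while
the words of weight two in this space that are supported on the other groups, together with zero,
lie in different cosets. Counting cosets gives `3 L ≤ q + 4` (`LocalChecks.le_of_partition`). For
`L = 3` the code is two-dimensional of length nine and the count is immediate
(`le_of_length_nine`).
-/

namespace SpreadLRC

/-! ### Parity checks supported on few coordinates -/

section Checks

variable {F : Type*} [Field F] {ι : Type*}

variable (F) in
/-- The words that vanish on `T`. -/
def vanishing (T : Finset ι) : Submodule F (ι → F) :=
  LinearMap.ker (LinearMap.funLeft F F (Subtype.val : T → ι))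

lemma mem_vanishing {T : Finset ι} {x : ι → F} :
    x ∈ vanishing F T ↔ ∀ t ∈ T, x t = 0 := by
  simp [vanishing, funext_iff, LinearMap.funLeft_apply]

variable [Fintype ι]

/-- The hyperplane of words that satisfy the parity check `w` (all words if `w = 0`). -/
def checkKer (w : ι → F) : Submodule F (ι → F) :=
  LinearMap.ker (Fintype.linearCombination F w)

lemma mem_checkKer {w x : ι → F} : x ∈ checkKer w ↔ ∑ j, w j * x j = 0 := by
  simp [checkKer, Fintype.linearCombination_apply, mul_comm]

lemma card_le_finrank_checkKer (w : ι → F) :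
    Fintype.card ι ≤ Module.finrank F (checkKer w) + 1 := by
  have h := LinearMap.finrank_range_add_finrank_ker (Fintype.linearCombination F w)
  have h2 := Submodule.finrank_le (LinearMap.range (Fintype.linearCombination F w))
  simp only [Module.finrank_self, Module.finrank_fintype_fun_eq_card] at h h2
  unfold checkKer
  omega

lemma card_le_finrank_vanishing (T : Finset ι) :
    Fintype.card ι ≤ Module.finrank F (vanishing F T) + T.card := by
  have h := LinearMap.finrank_range_add_finrank_ker
    (LinearMap.funLeft F F (Subtype.val : T → ι))
  have h2 := Submodule.finrank_le (LinearMap.range (LinearMap.funLeft F F (Subtype.val : T → ι)))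
  simp only [Module.finrank_fintype_fun_eq_card, Fintype.card_coe] at h h2
  unfold vanishing
  omega

/-- `m` independent parity checks of `D` are supported on `T`. This is encoded dually, through
the space `K` of the words that satisfy these checks. -/
def Captures (D : Submodule F (ι → F)) (T : Finset ι) (m : ℕ) : Prop :=
  ∃ K : Submodule F (ι → F), D ≤ K ∧ vanishing F T ≤ K ∧
    Module.finrank F K + m ≤ Fintype.card ι

lemma captures_empty (D : Submodule F (ι → F)) : Captures D ∅ 0 :=
  ⟨⊤, le_top, le_top, by simp⟩

/-- A check that involves a coordinate outside `T` is independent of the checks supported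
on `T`. -/
lemma Captures.step [DecidableEq ι] {D : Submodule F (ι → F)} {T : Finset ι} {m : ℕ}
    (h : Captures D T m) {w : ι → F} (hw : D ≤ checkKer w) {S : Finset ι}
    (hS : ∀ j, w j ≠ 0 → j ∈ S) {i : ι} (hi : i ∉ T) (hwi : w i ≠ 0) :
    Captures D (T ∪ S) (m + 1) := by
  obtain ⟨K, hDK, hTK, hK⟩ := h
  refine ⟨K ⊓ checkKer w, le_inf hDK hw, fun x hx => ⟨hTK ?_, ?_⟩, ?_⟩
  · rw [mem_vanishing] at hx ⊢
    exact fun t ht => hx t (Finset.mem_union_left _ ht)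
  · rw [mem_vanishing] at hx
    rw [SetLike.mem_coe, mem_checkKer]
    refine Finset.sum_eq_zero fun j _ => ?_
    by_cases hj : w j = 0
    · simp [hj]
    · simp [hx j (Finset.mem_union_right _ (hS j hj))]
  · have hlt : K ⊓ checkKer w < K := by
      refine lt_of_le_of_ne inf_le_left fun heq => ?_
      have he : Pi.single i (1 : F) ∈ K := by
        apply hTK
        rw [mem_vanishing]
        intro t ht
        exact Pi.single_eq_of_ne (fun h : t = i => hi (h ▸ ht)) _
      rw [← heq] at he
      have := mem_checkKer.1 he.2
      simp [Pi.single_apply] at this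
      exact hwi this
    have := Submodule.finrank_lt_finrank_of_lt hlt
    omega

/-- A code of dimension more than `#T - m` has a nonzero word vanishing on `T`. -/
lemma Captures.exists_codeword {C : Submodule F (ι → F)} {T : Finset ι} {m : ℕ}
    (h : Captures C T m) (hT : T.card < Module.finrank F C + m) :
    ∃ x ∈ C, x ≠ 0 ∧ ∀ t ∈ T, x t = 0 := by
  obtain ⟨K, hCK, hTK, hK⟩ := h
  have h1 := Submodule.finrank_sup_add_finrank_inf_eq C (vanishing F T)
  have h2 := Submodule.finrank_mono (sup_le hCK hTK)
  have h3 := card_le_finrank_vanishing (F := F) T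
  have h4 : C ⊓ vanishing F T ≠ ⊥ := by
    intro h0
    rw [h0, finrank_bot] at h1
    omega
  obtain ⟨x, hx, hx0⟩ := Submodule.exists_mem_ne_zero_of_ne_bot h4
  exact ⟨x, hx.1, hx0, mem_vanishing.1 hx.2⟩

lemma Captures.mono {D : Submodule F (ι → F)} {T T' : Finset ι} {m : ℕ}
    (h : Captures D T m) (hT : T ⊆ T') : Captures D T' m := by
  obtain ⟨K, hDK, hTK, hK⟩ := h
  refine ⟨K, hDK, fun x hx => hTK ?_, hK⟩
  rw [mem_vanishing] at hx ⊢
  exact fun t ht => hx t (hT ht)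

/-- A choice of local checks of `D` with at most three terms: `S i` is a group containing the
coordinate `i`, and `v G` is a check with support `G` for each of these groups `G`. The check
depends on the group only. -/
structure LocalChecks (D : Submodule F (ι → F)) (S : ι → Finset ι) (v : Finset ι → ι → F) :
    Prop where
  mem : ∀ i, i ∈ S i
  card_le : ∀ i, (S i).card ≤ 3
  support : ∀ i j, v (S i) j ≠ 0 ↔ j ∈ S i
  le_ker : ∀ i, D ≤ checkKer (v (S i))

lemma exists_localChecks [DecidableEq ι] {C : Submodule F (ι → F)}
    (h : ∀ i : ι, ∃ R : Finset ι, IsRepairSet C i R ∧ R.card ≤ 2) :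
    ∃ S v, LocalChecks C S v := by
  classical
  choose R hR hRc using h
  have key : ∀ i, ∃ w : ι → F, (∀ j, w j ≠ 0 ↔ j ∈ insert i (R i)) ∧ C ≤ checkKer w := by
    intro i
    obtain ⟨hi, κ, hκ, hc⟩ := hR i
    refine ⟨fun j => if j = i then -1 else if j ∈ R i then κ j else 0, fun j => ?_, fun c hcC => ?_⟩
    · by_cases hj : j = i
      · simp [hj]
      · by_cases hj' : j ∈ R i
        · simp [hj, hj', hκ j hj']
        · simp [hj, hj']
    · rw [mem_checkKer, ← Finset.add_sum_erase _ _ (Finset.mem_univ i)]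
      have : ∑ j ∈ Finset.univ.erase i,
          (if j = i then (-1 : F) else if j ∈ R i then κ j else 0) * c j
            = ∑ j ∈ R i, κ j * c j := by
        rw [← Finset.sum_subset (s₁ := R i)]
        · refine Finset.sum_congr rfl fun j hj => ?_
          have : j ≠ i := fun h => hi (h ▸ hj)
          simp [this, hj]
        · intro j hj
          exact Finset.mem_erase.2 ⟨fun h => hi (h ▸ hj), Finset.mem_univ _⟩
        · intro j hj hj'
          simp [Finset.ne_of_mem_erase hj, hj']
      rw [this, ← hc c hcC]
      simp
  let v : Finset ι → ι → F := fun G =>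
    if h : ∃ w : ι → F, (∀ j, w j ≠ 0 ↔ j ∈ G) ∧ C ≤ checkKer w then h.choose else 0
  have hv : ∀ i, (∀ j, v (insert i (R i)) j ≠ 0 ↔ j ∈ insert i (R i)) ∧
      C ≤ checkKer (v (insert i (R i))) := by
    intro i
    simp only [v]
    rw [dif_pos (key i)]
    exact (key i).choose_spec
  exact ⟨fun i => insert i (R i), v, fun i => Finset.mem_insert_self _ _,
    fun i => (Finset.card_insert_le _ _).trans (by have := hRc i; omega),
    fun i => (hv i).1, fun i => (hv i).2⟩

/-- Greedy choice of checks: each new one involves an uncovered coordinate and covers at most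
three new ones, so that a saving of `s` coordinates made at the start is kept. -/
lemma LocalChecks.extend [DecidableEq ι] {D : Submodule F (ι → F)} {S : ι → Finset ι}
    {v : Finset ι → ι → F} (h : LocalChecks D S v) {T : Finset ι} {m M s : ℕ}
    (hT : Captures D T m) (hs : T.card + s ≤ 3 * m) (hmM : m ≤ M)
    (hM : 3 * M ≤ Fintype.card ι) :
    ∃ T' : Finset ι, T'.card + s ≤ 3 * M ∧ Captures D T' M := by
  induction M, hmM using Nat.le_induction with
  | base => exact ⟨T, hs, hT⟩
  | succ M hmM ih =>
    obtain ⟨T', hT', hcap⟩ := ih (by omega)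
    obtain ⟨i, hi⟩ : ∃ i, i ∉ T' := by
      by_contra! hall
      have : T' = Finset.univ := Finset.eq_univ_iff_forall.2 hall
      rw [this, Finset.card_univ] at hT'
      omega
    refine ⟨T' ∪ S i, ?_, hcap.step (h.le_ker i) (fun j => (h.support i j).1) hi
      ((h.support i i).2 (h.mem i))⟩
    have := Finset.card_union_le T' (S i)
    have := h.card_le i
    omega

end Checks

/-! ### Distance eight forces a short code -/

section Bound

variable {F : Type*} [Field F] {ι : Type*} [Fintype ι] [DecidableEq ι]

/-- A set that carries one check more than `#T - dim C` allows yields a codeword supported on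
seven coordinates. -/
lemma LocalChecks.false_of_saving {C : Submodule F (ι → F)} {S : ι → Finset ι}
    {v : Finset ι → ι → F} (h : LocalChecks C S v) {L : ℕ} (hL : 3 ≤ L)
    (hn : Fintype.card ι = 3 * L) (hk : Module.finrank F C = 2 * L - 4)
    (hd : ∀ x ∈ C, ∀ A : Finset ι, A.card ≤ 7 → (∀ j ∉ A, x j = 0) → x = 0)
    {T : Finset ι} {m : ℕ} (hT : Captures C T m) (hm : m ≤ L - 2) (hs : T.card + 1 ≤ 3 * m) :
    False := by
  obtain ⟨T', hT', hcap⟩ := h.extend hT hs hm (by omega)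
  obtain ⟨T'', hsub, -, hcard⟩ := Finset.exists_subsuperset_card_eq (Finset.subset_univ T')
    (n := 3 * L - 7) (by omega) (by rw [Finset.card_univ]; omega)
  obtain ⟨x, hxC, hx0, hxT⟩ := (hcap.mono hsub).exists_codeword (by omega)
  refine hx0 (hd x hxC T''ᶜ ?_ fun j hj => hxT j (by simpa using hj))
  rw [Finset.card_compl]
  omega

lemma LocalChecks.card_eq_three {C : Submodule F (ι → F)} {S : ι → Finset ι}
    {v : Finset ι → ι → F} (h : LocalChecks C S v) {L : ℕ} (hL : 3 ≤ L)
    (hn : Fintype.card ι = 3 * L) (hk : Module.finrank F C = 2 * L - 4)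
    (hd : ∀ x ∈ C, ∀ A : Finset ι, A.card ≤ 7 → (∀ j ∉ A, x j = 0) → x = 0) (i : ι) :
    (S i).card = 3 := by
  by_contra hne
  have := h.card_le i
  have hcap := (captures_empty C).step (h.le_ker i) (fun j => (h.support i j).1)
    (Finset.notMem_empty i) ((h.support i i).2 (h.mem i))
  rw [Finset.empty_union] at hcap
  exact h.false_of_saving hL hn hk hd hcap (by omega) (by omega)

lemma LocalChecks.eq_of_not_disjoint {C : Submodule F (ι → F)} {S : ι → Finset ι}
    {v : Finset ι → ι → F} (h : LocalChecks C S v) {L : ℕ} (hL : 4 ≤ L)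
    (hn : Fintype.card ι = 3 * L) (hk : Module.finrank F C = 2 * L - 4)
    (hd : ∀ x ∈ C, ∀ A : Finset ι, A.card ≤ 7 → (∀ j ∉ A, x j = 0) → x = 0) {i j l : ι}
    (hi : l ∈ S i) (hj : l ∈ S j) : S i = S j := by
  have hci := h.card_eq_three (by omega) hn hk hd i
  have hcj := h.card_eq_three (by omega) hn hk hd j
  by_contra hne
  obtain ⟨t, htj, hti⟩ : ∃ t ∈ S j, t ∉ S i := by
    by_contra! hsub
    exact hne (Finset.eq_of_subset_of_card_le hsub (by omega)).symm
  have hcap := (captures_empty C).step (h.le_ker i) (fun j => (h.support i j).1)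
    (Finset.notMem_empty i) ((h.support i i).2 (h.mem i))
  rw [Finset.empty_union] at hcap
  have hcap2 := hcap.step (h.le_ker j) (fun l => (h.support j l).1) hti
    ((h.support j t).2 htj)
  refine h.false_of_saving (by omega) hn hk hd hcap2 (by omega) ?_
  have h1 := Finset.card_union_add_card_inter (S i) (S j)
  have h2 : 0 < (S i ∩ S j).card := Finset.card_pos.2 ⟨l, Finset.mem_inter.2 ⟨hi, hj⟩⟩
  omega

/-- A check with support of size three is satisfied by a word whose support is any two of the
three coordinates. -/
lemma exists_word_of_check {w : ι → F} {G : Finset ι} (hG : G.card = 3)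
    (hw : ∀ j, w j ≠ 0 ↔ j ∈ G) {a : ι} (ha : a ∈ G) :
    ∃ e : ι → F, (∀ j, e j ≠ 0 ↔ j ∈ G.erase a) ∧ e ∈ checkKer w := by
  obtain ⟨b, c, hbc, hGe⟩ := Finset.card_eq_two.1
    (show (G.erase a).card = 2 by rw [Finset.card_erase_of_mem ha, hG])
  have hb : w b ≠ 0 := (hw b).2 (Finset.mem_of_mem_erase (by rw [hGe]; simp))
  have hc : w c ≠ 0 := (hw c).2 (Finset.mem_of_mem_erase (by rw [hGe]; simp))
  refine ⟨Pi.single b (w c) - Pi.single c (w b), fun j => ?_, ?_⟩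
  · rw [hGe, Finset.mem_insert, Finset.mem_singleton]
    by_cases h1 : j = b
    · subst h1
      simp [hbc, hc]
    · by_cases h2 : j = c
      · subst h2
        simp [h1, hb]
      · simp [h1, h2]
  · rw [mem_checkKer]
    simp only [Pi.sub_apply, mul_sub, Finset.sum_sub_distrib]
    simp [Pi.single_apply, mul_comm]

variable [Fintype F]

open Classical in
/-- Seven erasures being correctable bounds the number of the words of weight two with local
checks: they lie in different cosets of the sum of the code and the words supported on one
group `S i₀`, which has codimension two in the space of words with all the local checks. -/
lemma LocalChecks.le_of_partition {C : Submodule F (ι → F)} {S : ι → Finset ι}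
    {v : Finset ι → ι → F} (h : LocalChecks C S v) {L : ℕ} (hL : 3 ≤ L)
    (hn : Fintype.card ι = 3 * L) (hk : Module.finrank F C = 2 * L - 4)
    (hd : ∀ x ∈ C, ∀ A : Finset ι, A.card ≤ 7 → (∀ j ∉ A, x j = 0) → x = 0)
    (h3 : ∀ i, (S i).card = 3) (hpart : ∀ i j l, l ∈ S i → l ∈ S j → S i = S j) :
    3 * L ≤ Fintype.card F + 4 := by
  have : Nonempty ι := Fintype.card_pos_iff.1 (by omega)
  obtain ⟨i₀⟩ := this
  let D : Submodule F (ι → F) := ⨅ i, checkKer (v (S i))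
  have hCD : C ≤ D := le_iInf h.le_ker
  have hD : LocalChecks D S v := ⟨h.mem, h.card_le, h.support, iInf_le _⟩
  have hDfin : Module.finrank F D ≤ 2 * L := by
    obtain ⟨T, -, K, hDK, -, hK⟩ := hD.extend (captures_empty D) (s := 0) (by simp)
      (Nat.zero_le L) hn.ge
    have := Submodule.finrank_mono hDK
    omega
  -- a word supported on one group and satisfying its check satisfies all checks
  have hmemD : ∀ i x, (∀ j, x j ≠ 0 → j ∈ S i) → x ∈ checkKer (v (S i)) → x ∈ D := by
    intro i x hx hxi
    refine (Submodule.mem_iInf _).2 fun j => ?_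
    by_cases hij : S i = S j
    · rwa [← hij]
    · rw [mem_checkKer]
      refine Finset.sum_eq_zero fun l _ => ?_
      by_contra hne
      have hl1 := hx l (right_ne_zero_of_mul hne)
      have hl2 := (h.support j l).1 (left_ne_zero_of_mul hne)
      exact hij (hpart i j l hl1 hl2)
  let Y : Submodule F (ι → F) := vanishing F (S i₀)ᶜ ⊓ checkKer (v (S i₀))
  have hYsupp : ∀ y ∈ Y, ∀ j ∉ S i₀, y j = 0 := fun y hy j hj =>
    mem_vanishing.1 hy.1 j (Finset.mem_compl.2 hj)
  have hYD : Y ≤ D := fun y hy =>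
    hmemD i₀ y (fun j hj => by_contra fun hj' => hj (hYsupp y hy j hj')) hy.2
  have hYfin : 2 ≤ Module.finrank F Y := by
    have h1 := Submodule.finrank_sup_add_finrank_inf_eq (vanishing F (S i₀)ᶜ)
      (checkKer (v (S i₀)))
    have h2 := card_le_finrank_vanishing (F := F) (S i₀)ᶜ
    have h4 := card_le_finrank_checkKer (v (S i₀))
    have h5 := Submodule.finrank_le (vanishing F (S i₀)ᶜ ⊔ checkKer (v (S i₀)))
    rw [Module.finrank_fintype_fun_eq_card] at h5
    rw [Finset.card_compl, h3] at h2
    change 2 ≤ Module.finrank F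
      (vanishing F (S i₀)ᶜ ⊓ checkKer (v (S i₀)) : Submodule F (ι → F))
    omega
  have hCY : Module.finrank F (C ⊔ Y : Submodule F (ι → F)) ≥ 2 * L - 2 := by
    have h1 := Submodule.finrank_sup_add_finrank_inf_eq C Y
    have h2 : C ⊓ Y = ⊥ := by
      refine (Submodule.eq_bot_iff _).2 fun x hx => ?_
      exact hd x hx.1 (S i₀) (by rw [h3]; norm_num) (hYsupp x hx.2)
    rw [h2, finrank_bot] at h1
    omega
  choose e he hek using fun a => exists_word_of_check (h3 a) (h.support a) (h.mem a)
  have heD : ∀ a, e a ∈ D := fun a =>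
    hmemD a (e a) (fun j hj => Finset.mem_of_mem_erase ((he a j).1 hj)) (hek a)
  let g : Option (Fˣ × {a // a ∉ S i₀}) → ι → F := fun o =>
    o.elim 0 fun p => (p.1 : F) • e p.2
  have hgD : ∀ o, g o ∈ D := by
    rintro (_ | ⟨t, a⟩)
    · exact D.zero_mem
    · exact D.smul_mem _ (heD a)
  let supp : Option (Fˣ × {a // a ∉ S i₀}) → Finset ι := fun o =>
    o.elim ∅ fun p => (S p.2).erase p.2
  have hgs : ∀ o j, g o j ≠ 0 ↔ j ∈ supp o := by
    rintro (_ | ⟨t, a⟩) j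
    · simp [g, supp]
    · simpa [g, supp] using he a j
  have hsc : ∀ o, (supp o).card ≤ 2 := by
    rintro (_ | ⟨t, a⟩)
    · simp [supp]
    · simp [supp, Finset.card_erase_of_mem (h.mem a), h3]
  have hsd : ∀ o, ∀ j ∈ supp o, j ∉ S i₀ := by
    rintro (_ | ⟨t, a⟩) j hj hj0
    · simp [supp] at hj
    · have := hpart a i₀ j (Finset.mem_of_mem_erase hj) hj0
      exact a.2 (this.subset (h.mem a))
  have hginj : Function.Injective g := by
    have hne : ∀ t : Fˣ, ∀ a : {a // a ∉ S i₀}, supp (some (t, a)) ≠ ∅ := by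
      intro t a h0
      have : ((S a).erase a).card = 0 := by
        change (supp (some (t, a))).card = 0
        rw [h0]; rfl
      rw [Finset.card_erase_of_mem (h.mem a), h3] at this
      omega
    have hsg : ∀ o o', g o = g o' → supp o = supp o' := fun o o' hoo => by
      ext j
      rw [← hgs, ← hgs, hoo]
    rintro (_ | ⟨t, a⟩) (_ | ⟨t', a'⟩) hoo
    · rfl
    · exact absurd (hsg _ _ hoo).symm (hne t' a')
    · exact absurd (hsg _ _ hoo) (hne t a)
    · have hs := hsg _ _ hoo
      obtain ⟨j, hj⟩ := Finset.nonempty_iff_ne_empty.2 (hne t a)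
      have hj' := hj
      rw [hs] at hj'
      have hS := hpart a a' j (Finset.mem_of_mem_erase hj) (Finset.mem_of_mem_erase hj')
      have haa : (a : ι) = a' := by
        by_contra hne
        have h1 : (a : ι) ∈ supp (some (t', a')) :=
          Finset.mem_erase.2 ⟨hne, hS ▸ h.mem a⟩
        rw [← hs] at h1
        exact Finset.notMem_erase _ _ h1
      obtain rfl : a = a' := Subtype.ext haa
      have hj0 : e a j ≠ 0 := (he a j).2 hj
      have := congrFun hoo j
      simp only [g, Option.elim, Pi.smul_apply, smul_eq_mul] at this
      rw [Units.ext (mul_right_cancel₀ hj0 this)]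
  let f : (C ⊔ Y : Submodule F (ι → F)) × Option (Fˣ × {a // a ∉ S i₀}) → D := fun p =>
    ⟨p.1 + g p.2, D.add_mem (sup_le hCD hYD p.1.2) (hgD _)⟩
  have hf : Function.Injective f := by
    rintro ⟨⟨x, hx⟩, o⟩ ⟨⟨x', hx'⟩, o'⟩ hxx
    have hsum : x + g o = x' + g o' := congrArg Subtype.val hxx
    obtain ⟨c, hc, y, hy, hcy⟩ := Submodule.mem_sup.1 (Submodule.sub_mem _ hx hx')
    have hrel : c + y = g o' - g o := by
      rw [hcy, sub_eq_sub_iff_add_eq_add, hsum, add_comm]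
    have hc0 : c = 0 := by
      refine hd c hc (S i₀ ∪ (supp o ∪ supp o')) ?_ fun j hj => ?_
      · have := Finset.card_union_le (S i₀) (supp o ∪ supp o')
        have := Finset.card_union_le (supp o) (supp o')
        have := hsc o
        have := hsc o'
        have := h3 i₀
        omega
      · simp only [Finset.mem_union, not_or] at hj
        have h1 := congrFun hrel j
        have h2 : g o j = 0 := by_contra fun h0 => hj.2.1 ((hgs o j).1 h0)
        have h4 : g o' j = 0 := by_contra fun h0 => hj.2.2 ((hgs o' j).1 h0)
        simpa [hYsupp y hy j hj.1, h2, h4] using h1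
    have hgg : g o = g o' := by
      funext j
      have h1 := congrFun hrel j
      by_cases hj : j ∈ S i₀
      · have h2 : g o j = 0 := by_contra fun h0 => hsd o j ((hgs o j).1 h0) hj
        have h4 : g o' j = 0 := by_contra fun h0 => hsd o' j ((hgs o' j).1 h0) hj
        rw [h2, h4]
      · simp only [hc0, Pi.add_apply, Pi.sub_apply, Pi.zero_apply, hYsupp y hy j hj] at h1
        simp only [zero_add] at h1
        exact (sub_eq_zero.1 h1.symm).symm
    have hoo := hginj hgg
    subst hoo
    simpa using hsum
  have hcard := Fintype.card_le_of_injective f hf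
  have hq : 1 < Fintype.card F := Fintype.one_lt_card
  rw [Fintype.card_prod, Fintype.card_option, Fintype.card_prod, Fintype.card_units,
    Fintype.card_subtype_compl, Fintype.card_coe, h3, hn,
    Module.card_eq_pow_finrank (K := F) (V := D),
    Module.card_eq_pow_finrank (K := F) (V := (C ⊔ Y : Submodule F (ι → F)))] at hcard
  obtain ⟨r, hr⟩ : ∃ r, Fintype.card F = r + 1 := ⟨Fintype.card F - 1, by omega⟩
  have hpow : Fintype.card F ^ (2 * L - 2) * ((Fintype.card F - 1) * (3 * L - 3) + 1)
      ≤ Fintype.card F ^ (2 * L - 2) * Fintype.card F ^ 2 := by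
    refine (Nat.mul_le_mul_right _ (Nat.pow_le_pow_right (by omega) hCY)).trans
      (hcard.trans ?_)
    rw [← pow_add]
    exact Nat.pow_le_pow_right (by omega) (by omega)
  have hle := Nat.le_of_mul_le_mul_left hpow (by positivity)
  obtain ⟨M, rfl⟩ : ∃ M, L = M + 1 := ⟨L - 1, by omega⟩
  rw [hr] at hle ⊢
  have h6 : 3 * (M + 1) - 3 = 3 * M := by omega
  rw [h6, Nat.add_sub_cancel] at hle
  have h7 : 3 * M ≤ r + 2 := by
    by_contra! hcon
    nlinarith
  omega

/-- The case of three groups, where locality gives nothing: for each of the nine coordinates a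
plane of codewords has a nonzero word vanishing there, and no word vanishes at two of them. -/
lemma le_of_length_nine {C : Submodule F (ι → F)} (hn : Fintype.card ι = 9)
    (hk : Module.finrank F C = 2)
    (hd : ∀ x ∈ C, ∀ A : Finset ι, A.card ≤ 7 → (∀ j ∉ A, x j = 0) → x = 0) :
    9 ≤ Fintype.card F + 4 := by
  classical
  have hex : ∀ i : ι, ∃ x ∈ C, x ≠ 0 ∧ x i = 0 := by
    intro i
    obtain ⟨x, hx, hx0, hxi⟩ := ((captures_empty C).mono (Finset.empty_subset {i})).exists_codeword
      (by rw [hk]; simp)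
    exact ⟨x, hx, hx0, hxi i (by simp)⟩
  choose c hcC hc0 hci using hex
  let f : Option (Fˣ × ι) → C := fun o => o.elim 0 fun p => (p.1 : F) • ⟨c p.2, hcC p.2⟩
  have hf : Function.Injective f := by
    rintro (_ | ⟨t, a⟩) (_ | ⟨t', a'⟩) hoo
    · rfl
    · have := congrArg Subtype.val hoo
      simp [f, eq_comm, hc0] at this
    · have := congrArg Subtype.val hoo
      simp [f, hc0] at this
    · have hval : (t : F) • c a = (t' : F) • c a' := congrArg Subtype.val hoo
      have haa : a = a' := by
        by_contra hne
        refine hc0 a (hd (c a) (hcC a) {a, a'}ᶜ ?_ fun j hj => ?_)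
        · rw [Finset.card_compl, Finset.card_pair hne, hn]
        · simp only [Finset.mem_compl, not_not, Finset.mem_insert, Finset.mem_singleton] at hj
          rcases hj with rfl | rfl
          · exact hci _
          · have := congrFun hval j
            simpa [hci] using this
      subst haa
      rw [Units.ext (smul_left_injective F (hc0 a) hval)]
  have hcard := Fintype.card_le_of_injective f hf
  rw [Fintype.card_option, Fintype.card_prod, Fintype.card_units, hn,
    Module.card_eq_pow_finrank (K := F) (V := C), hk] at hcard
  have hq : 1 < Fintype.card F := Fintype.one_lt_card
  obtain ⟨r, hr⟩ : ∃ r, Fintype.card F = r + 1 := ⟨Fintype.card F - 1, by omega⟩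
  rw [hr, Nat.add_sub_cancel] at hcard
  rw [hr]
  nlinarith

/-- The minimum distance of a code of length `3 L > q + 4`, dimension `2 L - 4` and locality `2`
is at most seven, whatever its repair groups are. -/
theorem IsLRC.minDist_le_seven [DecidableEq F] {C : Submodule F (ι → F)} {L d : ℕ} (hL : 3 ≤ L)
    (hq : Fintype.card F + 4 < 3 * L) (h : IsLRC C (3 * L) (2 * L - 4) d 2) : d ≤ 7 := by
  by_contra! hd8
  have hn := h.length_eq
  have hk := h.dim_eq
  have hd : ∀ x ∈ C, ∀ A : Finset ι, A.card ≤ 7 → (∀ j ∉ A, x j = 0) → x = 0 := by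
    intro x hx A hA hxA
    by_contra hx0
    have h1 : d ≤ hammingDist x 0 := h.minDist.2 ⟨x, hx, 0, C.zero_mem, hx0, rfl⟩
    have h2 : hammingDist x 0 ≤ A.card := by
      rw [hammingDist_zero_right]
      refine Finset.card_le_card fun j hj => ?_
      by_contra hjA
      exact (Finset.mem_filter.1 hj).2 (hxA j hjA)
    omega
  obtain ⟨S, v, hS⟩ := exists_localChecks h.locality
  rcases hL.eq_or_lt with rfl | hL4
  · have := le_of_length_nine hn hk hd
    omega
  · have := hS.le_of_partition hL hn hk hd (hS.card_eq_three hL hn hk hd)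
      fun i j l => hS.eq_of_not_disjoint hL4 hn hk hd
    omega

end Bound

/-! ### Points of subspaces -/

lemma ncard_biUnion {α β : Type*} [Finite β] (s : Finset α) (t : α → Set β)
    (h : (s : Set α).PairwiseDisjoint t) : (⋃ i ∈ s, t i).ncard = ∑ i ∈ s, (t i).ncard := by
  have := s.finite_toSet.ncard_biUnion (fun i _ => Set.toFinite (t i)) h
  rw [finsum_mem_coe_finset] at this
  exact this

section Points

variable {F V : Type*} [Field F] [AddCommGroup V] [Module F V]

lemma disjoint_points {W W' : Submodule F V} (h : W ⊓ W' = ⊥) :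
    Disjoint (points W) (points W') := by
  rw [Set.disjoint_left]
  rintro l ⟨hl, h1⟩ ⟨hl', -⟩
  have : l = ⊥ := le_bot_iff.1 (h ▸ le_inf hl hl')
  rw [this, finrank_bot] at h1
  omega

lemma span_singleton_mem_points {W : Submodule F V} {x : V} (hx : x ∈ W) (hx0 : x ≠ 0) :
    Submodule.span F {x} ∈ points W :=
  ⟨(Submodule.span_singleton_le_iff_mem _ _).2 hx, finrank_span_singleton hx0⟩

lemma ncard_points [Fintype F] (W : Submodule F V) {n : ℕ} (hW : Module.finrank F W = n) :
    (points W).ncard = ∑ i ∈ Finset.range n, Fintype.card F ^ i := by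
  have h : points W = Submodule.map W.subtype '' {H : Submodule F W | Module.finrank F H = 1} := by
    ext l
    constructor
    · rintro ⟨hl, h1⟩
      have hmap : Submodule.map W.subtype (Submodule.comap W.subtype l) = l := by
        rw [Submodule.map_comap_subtype, inf_eq_right.2 hl]
      refine ⟨Submodule.comap W.subtype l, ?_, hmap⟩
      rw [Set.mem_ofPred_eq, ← h1]
      conv_rhs => rw [← hmap]
      exact (Submodule.finrank_map_subtype_eq _ _).symm
    · rintro ⟨H, hH, rfl⟩
      exact ⟨Submodule.map_subtype_le _ _, (Submodule.finrank_map_subtype_eq _ _).trans hH⟩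
  rw [h, Set.ncard_image_of_injective _ (Submodule.map_injective_of_injective
    W.subtype_injective), ← Nat.card_coe_set_eq]
  change Nat.card {H : Submodule F W // Module.finrank F H = 1} = _
  rw [← Nat.card_congr (Projectivization.equivSubmodule F W),
    Projectivization.card_of_finrank F W hW, Nat.card_eq_fintype_card]

variable [FiniteDimensional F V]

lemma span_singleton_eq {l : Submodule F V} (hl : Module.finrank F l = 1) {x : V} (hx : x ∈ l)
    (hx0 : x ≠ 0) : Submodule.span F {x} = l :=
  Submodule.eq_of_le_of_finrank_eq ((Submodule.span_singleton_le_iff_mem _ _).2 hx)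
    (by rw [finrank_span_singleton hx0, hl])

lemma sup_eq_of_mem_points {W l l' : Submodule F V} (hW : Module.finrank F W = 2)
    (hl : l ∈ points W) (hl' : l' ∈ points W) (hne : l ≠ l') : l ⊔ l' = W := by
  refine Submodule.eq_of_le_of_finrank_le (sup_le hl.1 hl'.1) ?_
  have hlt : l < l ⊔ l' := by
    refine lt_of_le_of_ne le_sup_left fun h => hne ?_
    have hle : l' ≤ l := by rw [h]; exact le_sup_right
    exact (Submodule.eq_of_le_of_finrank_eq hle (by rw [hl.2, hl'.2])).symm
  have := Submodule.finrank_lt_finrank_of_lt hlt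
  rw [hl.2] at this
  omega

end Points

/-! ### Spreads -/

section Spreads

variable {F : Type*} [Field F]

/-- Linear maps whose kernels form a spread. With `θ ^ 2 = θ + c` and `F ^ 4` read as pairs of
elements `v 0 + v 1 θ`, `v 2 + v 3 θ` of `F(θ)`, the kernel is the graph of the multiplication by
`a + b θ` for `some (a, b)`, and the second summand for `none`. -/
def spreadMap (c : F) (o : Option (F × F)) : (Fin 4 → F) →ₗ[F] F × F :=
  o.elim ((LinearMap.proj 0).prod (LinearMap.proj 1)) fun p =>
    LinearMap.prod
      (LinearMap.proj 2 - p.1 • LinearMap.proj 0 - (c * p.2) • LinearMap.proj 1)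
      (LinearMap.proj 3 - p.2 • LinearMap.proj 0 - (p.1 + p.2) • LinearMap.proj 1)

lemma mem_ker_spreadMap_none {c : F} {v : Fin 4 → F} :
    v ∈ LinearMap.ker (spreadMap c none) ↔ v 0 = 0 ∧ v 1 = 0 := by
  simp [spreadMap]

lemma mem_ker_spreadMap_some {c a b : F} {v : Fin 4 → F} :
    v ∈ LinearMap.ker (spreadMap c (some (a, b))) ↔
      v 2 - a * v 0 - c * b * v 1 = 0 ∧ v 3 - b * v 0 - (a + b) * v 1 = 0 := by
  simp [spreadMap]

/-- The norm form of `F(θ)` is anisotropic. -/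
lemma norm_ne_zero {c : F} (hc : ∀ x : F, x ^ 2 - x ≠ c) {x y : F} (h : x ≠ 0 ∨ y ≠ 0) :
    x * (x + y) - c * y ^ 2 ≠ 0 := by
  intro h0
  by_cases hy : y = 0
  · subst hy
    simp at h h0
    exact h h0
  · refine hc (-x / y) ?_
    field_simp
    linear_combination h0

variable [Fintype F]

/-- The points of `F ^ 4` are partitioned by the members of a spread. -/
lemma IsSpread.ncard_eq {P : Set (Submodule F (Fin 4 → F))} (hP : IsSpread 2 P) :
    P.ncard = Fintype.card F ^ 2 + 1 := by
  classical
  have hfin : P.Finite := Set.toFinite P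
  have hU : points (⊤ : Submodule F (Fin 4 → F)) = ⋃ W ∈ hfin.toFinset, points W := by
    ext l
    simp only [Set.mem_iUnion, Set.Finite.mem_toFinset, exists_prop]
    constructor
    · rintro ⟨-, h1⟩
      have hne : l ≠ ⊥ := by
        rintro rfl
        rw [finrank_bot] at h1
        omega
      obtain ⟨x, hx, hx0⟩ := Submodule.exists_mem_ne_zero_of_ne_bot hne
      obtain ⟨W, hW, hxW⟩ := hP.covers x
      exact ⟨W, hW, span_singleton_eq h1 hx hx0 ▸ span_singleton_mem_points hxW hx0⟩
    · rintro ⟨W, -, hl⟩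
      exact ⟨le_top, hl.2⟩
  have hcard : (points (⊤ : Submodule F (Fin 4 → F))).ncard
      = ∑ W ∈ hfin.toFinset, (points W).ncard := by
    rw [hU]
    refine ncard_biUnion _ _ fun W hW W' hW' hne => ?_
    exact disjoint_points (hP.inter_eq_bot W (by simpa using hW) W' (by simpa using hW') hne)
  rw [ncard_points ⊤ (n := 4) (by simp),
    Finset.sum_congr rfl fun W hW => ncard_points W (hP.finrank_eq W (by simpa using hW)),
    Finset.sum_const, smul_eq_mul, ← Set.ncard_eq_toFinset_card] at hcard
  simp only [Finset.sum_range_succ, Finset.sum_range_zero, pow_zero, pow_one, zero_add] at hcard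
  have : (1 + Fintype.card F) * P.ncard = (1 + Fintype.card F) * (Fintype.card F ^ 2 + 1) := by
    rw [mul_comm, ← hcard]
    ring
  exact Nat.eq_of_mul_eq_mul_left (by omega) this

/-- As `x ↦ x ^ 2 - x` takes the value `0` twice, it misses some `c`. -/
lemma exists_sq_sub_ne : ∃ c : F, ∀ x : F, x ^ 2 - x ≠ c := by
  by_contra! h
  have hinj : Function.Injective fun x : F => x ^ 2 - x :=
    Finite.injective_iff_surjective.2 h
  exact zero_ne_one (hinj (show (0 : F) ^ 2 - 0 = 1 ^ 2 - 1 by ring))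

theorem exists_isSpread : ∃ P : Set (Submodule F (Fin 4 → F)), IsSpread 2 P := by
  obtain ⟨c, hc⟩ := exists_sq_sub_ne (F := F)
  refine ⟨Set.range fun o => LinearMap.ker (spreadMap c o), ?_, ?_, ?_⟩
  · rintro _ ⟨o, rfl⟩
    have hsurj : LinearMap.range (spreadMap c o) = ⊤ := by
      rw [LinearMap.range_eq_top]
      rintro ⟨s, t⟩
      rcases o with _ | ⟨a, b⟩
      · exact ⟨![s, t, 0, 0], by simp [spreadMap]⟩
      · exact ⟨![0, 0, s, t], by simp [spreadMap]⟩
    have := LinearMap.finrank_range_add_finrank_ker (spreadMap c o)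
    rw [hsurj, finrank_top, Module.finrank_prod, Module.finrank_self,
      Module.finrank_fintype_fun_eq_card, Fintype.card_fin] at this
    dsimp only
    omega
  · rintro _ ⟨o, rfl⟩ _ ⟨o', rfl⟩ hne
    refine (Submodule.eq_bot_iff _).2 fun v hv => ?_
    have h1 := hv.1
    have h2 := hv.2
    have hoo : o ≠ o' := fun h => hne (by rw [h])
    clear hv hne
    -- it suffices that the first two coordinates vanish
    have hfin : ∀ o, v ∈ LinearMap.ker (spreadMap c (some o)) → v 0 = 0 → v 1 = 0 → v = 0 := by
      rintro ⟨a, b⟩ h h0 h1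
      rw [mem_ker_spreadMap_some, h0, h1] at h
      simp only [mul_zero, sub_zero] at h
      funext i
      fin_cases i
      exacts [h0, h1, h.1, h.2]
    rcases o with _ | ⟨a, b⟩ <;> rcases o' with _ | ⟨a', b'⟩
    · exact absurd rfl hoo
    · exact hfin _ h2 (mem_ker_spreadMap_none.1 h1).1 (mem_ker_spreadMap_none.1 h1).2
    · exact hfin _ h1 (mem_ker_spreadMap_none.1 h2).1 (mem_ker_spreadMap_none.1 h2).2
    · have hd : a - a' ≠ 0 ∨ b - b' ≠ 0 := by
        by_contra! h
        exact hoo (by rw [sub_eq_zero.1 h.1, sub_eq_zero.1 h.2])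
      have hN := norm_ne_zero hc hd
      obtain ⟨e1, e2⟩ := mem_ker_spreadMap_some.1 h1
      obtain ⟨e3, e4⟩ := mem_ker_spreadMap_some.1 h2
      refine hfin _ h1 ?_ ?_
      · refine (mul_eq_zero.1 (?_ : ((a - a') * (a - a' + (b - b')) - c * (b - b') ^ 2) * v 0
          = 0)).resolve_left hN
        linear_combination (a - a' + (b - b')) * (e3 - e1) - c * (b - b') * (e4 - e2)
      · refine (mul_eq_zero.1 (?_ : ((a - a') * (a - a' + (b - b')) - c * (b - b') ^ 2) * v 1
          = 0)).resolve_left hN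
        linear_combination (a - a') * (e4 - e2) - (b - b') * (e3 - e1)
  · intro v
    by_cases h : v 0 = 0 ∧ v 1 = 0
    · exact ⟨_, ⟨none, rfl⟩, mem_ker_spreadMap_none.2 h⟩
    · have hN := norm_ne_zero hc (x := v 0) (y := v 1) (by tauto)
      obtain ⟨N, hNdef⟩ : ∃ N, N = v 0 * (v 0 + v 1) - c * v 1 ^ 2 := ⟨_, rfl⟩
      rw [← hNdef] at hN
      refine ⟨_, ⟨some (((v 0 + v 1) * v 2 - c * v 1 * v 3) / N,
        (v 0 * v 3 - v 1 * v 2) / N), rfl⟩, mem_ker_spreadMap_some.2 ⟨?_, ?_⟩⟩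
      · field_simp
        rw [hNdef]
        ring
      · field_simp
        rw [hNdef]
        ring

end Spreads

/-! ### Pairs of vectors and the planes they span -/

section Pairs

variable {F : Type*} [Field F]

/-- The subspace spanned by a chosen pair; for a pair chosen by the algorithm this is the spread
member from which it was chosen. -/
def plane (p : (Fin 4 → F) × (Fin 4 → F)) : Submodule F (Fin 4 → F) :=
  Submodule.span F {p.1, p.2}

lemma triple_mem_plane (p : (Fin 4 → F) × (Fin 4 → F)) (a : Fin 3) : triple p a ∈ plane p := by
  have h1 : p.1 ∈ plane p := Submodule.subset_span (by simp)
  have h2 : p.2 ∈ plane p := Submodule.subset_span (by simp)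
  fin_cases a
  exacts [sub_mem h1 h2, h1, h2]

lemma eq_zero_of_smul_add_smul_eq_zero {p : (Fin 4 → F) × (Fin 4 → F)}
    (hp : Module.finrank F (plane p) = 2) {a b : F} (h : a • p.1 + b • p.2 = 0) :
    a = 0 ∧ b = 0 := by
  have hli : LinearIndependent F ![p.1, p.2] := by
    rw [linearIndependent_iff_card_eq_finrank_span, Set.finrank]
    have hr : Set.range ![p.1, p.2] = {p.1, p.2} := by
      simp [Matrix.range_cons, Set.pair_comm]
    rw [hr, Fintype.card_fin]
    exact hp.symm
  exact LinearIndependent.pair_iff.1 hli a b h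

/-- Any two of the vectors `u₀`, `u₁`, `u₂` are independent. -/
lemma triple_independent {p : (Fin 4 → F) × (Fin 4 → F)}
    (hp : Module.finrank F (plane p) = 2) {i j : Fin 3} (hij : i ≠ j) {a b : F}
    (h : a • triple p i + b • triple p j = 0) : a = 0 ∧ b = 0 := by
  have hcoord : ∀ i, triple p i = ![(1 : F), 1, 0] i • p.1 + ![(-1 : F), 0, 1] i • p.2 := by
    intro i
    fin_cases i <;> simp [triple, sub_eq_add_neg]
  rw [hcoord i, hcoord j] at h
  obtain ⟨h1, h2⟩ := eq_zero_of_smul_add_smul_eq_zero hp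
    (a := a * ![(1 : F), 1, 0] i + b * ![(1 : F), 1, 0] j)
    (b := a * ![(-1 : F), 0, 1] i + b * ![(-1 : F), 0, 1] j) (by rw [← h]; module)
  clear h hcoord hp
  fin_cases i <;> fin_cases j <;> simp at h1 h2 hij <;> simp_all

lemma triple_ne_zero {p : (Fin 4 → F) × (Fin 4 → F)}
    (hp : Module.finrank F (plane p) = 2) (i : Fin 3) : triple p i ≠ 0 := by
  intro h
  obtain ⟨j, hj⟩ : ∃ j, i ≠ j := ⟨i + 1, by fin_cases i <;> decide⟩
  exact one_ne_zero (triple_independent hp hj (a := 1) (b := 0) (by simp [h])).1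

lemma exists_areBases {W : Submodule F (Fin 4 → F)} (hW : Module.finrank F W = 2)
    {l : Fin 3 → Submodule F (Fin 4 → F)} (hl : Function.Injective l)
    (hlW : ∀ a, l a ∈ points W) : ∃ p, AreBases l p := by
  have hne : l 0 ≠ ⊥ := by
    intro h
    have := (hlW 0).2
    rw [h, finrank_bot] at this
    omega
  obtain ⟨x, hx, hx0⟩ := Submodule.exists_mem_ne_zero_of_ne_bot hne
  have hxW := (hlW 0).1 hx
  rw [← sup_eq_of_mem_points hW (hlW 1) (hlW 2) (hl.ne (by decide))] at hxW
  obtain ⟨y, hy, z, hz, hyz⟩ := Submodule.mem_sup.1 hxW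
  -- neither summand vanishes, as `l 0` is different from `l 2` and `l 1`
  have hdiff : ∀ a, a ≠ 0 → x ∉ l a := fun a ha hxa => hl.ne ha
    ((span_singleton_eq (hlW a).2 hxa hx0).symm.trans (span_singleton_eq (hlW 0).2 hx hx0))
  have hy0 : y ≠ 0 := by
    rintro rfl
    exact hdiff 2 (by decide) (by rw [← hyz, zero_add]; exact hz)
  have hz0 : z ≠ 0 := by
    rintro rfl
    exact hdiff 1 (by decide) (by rw [← hyz, add_zero]; exact hy)
  refine ⟨(y, -z), fun a => ?_⟩
  fin_cases a
  · exact span_singleton_eq (hlW 0).2 (by simpa [triple, hyz] using hx) (by simpa [triple, hyz])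
  · exact span_singleton_eq (hlW 1).2 (by simpa [triple] using hy) (by simpa [triple])
  · exact span_singleton_eq (hlW 2).2 (by simpa [triple] using hz) (by simpa [triple])

lemma plane_eq {W : Submodule F (Fin 4 → F)} (hW : Module.finrank F W = 2)
    {l : Fin 3 → Submodule F (Fin 4 → F)} (hl : Function.Injective l)
    (hlW : ∀ a, l a ∈ points W) {p : (Fin 4 → F) × (Fin 4 → F)} (hp : AreBases l p) :
    plane p = W := by
  rw [← sup_eq_of_mem_points hW (hlW 1) (hlW 2) (hl.ne (by decide)), ← hp 1, ← hp 2, plane,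
    Submodule.span_insert]
  rfl

end Pairs

/-! ### The states reached by the algorithm -/

section Invariant

variable {F : Type*} [Field F]

/-- All points deleted while the pairs `U` were chosen, in this order. -/
def deleted (U : List ((Fin 4 → F) × (Fin 4 → F))) : Set (Submodule F (Fin 4 → F)) :=
  {l | ∃ prev p, prev ++ [p] <+: U ∧ l ∈ forbidden prev p}

lemma deleted_nil : deleted ([] : List ((Fin 4 → F) × (Fin 4 → F))) = ∅ := by
  ext l
  simp [deleted]

lemma deleted_append (U : List ((Fin 4 → F) × (Fin 4 → F))) (p : (Fin 4 → F) × (Fin 4 → F)) :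
    deleted (U ++ [p]) = deleted U ∪ forbidden U p := by
  ext l
  simp only [deleted, Set.mem_ofPred_eq, Set.mem_union, List.prefix_concat_iff]
  constructor
  · rintro ⟨prev, p', h | h, hl⟩
    · obtain ⟨rfl, h2⟩ := List.append_inj' h rfl
      obtain rfl : p' = p := by simpa using h2
      exact Or.inr hl
    · exact Or.inl ⟨prev, p', h, hl⟩
  · rintro (⟨prev, p', h, hl⟩ | hl)
    · exact ⟨prev, p', Or.inr h, hl⟩
    · exact ⟨U, p, Or.inl rfl, hl⟩

/-- The family of the reachable states: the members of the spread from which no pair of `U` was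
chosen, without the deleted points, if at least three points are left. -/
def remaining (P : Set (Submodule F (Fin 4 → F))) (U : List ((Fin 4 → F) × (Fin 4 → F))) :
    Set (Set (Submodule F (Fin 4 → F))) :=
  {B | 3 ≤ B.ncard ∧ ∃ W ∈ P, (∀ p ∈ U, plane p ≠ W) ∧ B = points W \ deleted U}

/-- The pairs of `U` are chosen from different members of the spread, and each avoids the points
deleted before. -/
structure IsChoice (P : Set (Submodule F (Fin 4 → F))) (U : List ((Fin 4 → F) × (Fin 4 → F))) :
    Prop where
  mem : ∀ p ∈ U, plane p ∈ P
  nodup : (U.map plane).Nodup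
  avoid : ∀ prev p, prev ++ [p] <+: U → ∀ a, Submodule.span F {triple p a} ∉ deleted prev

lemma trim_eq {M : Set (Set (Submodule F (Fin 4 → F)))} (hM : ∀ B ∈ M, 3 ≤ B.ncard)
    (prev : List ((Fin 4 → F) × (Fin 4 → F))) (p : (Fin 4 → F) × (Fin 4 → F)) :
    trim M prev p = {B' | 3 ≤ B'.ncard ∧ ∃ B ∈ M, B' = B \ forbidden prev p} := by
  ext B'
  by_cases h : prev = []
  · subst h
    simp only [trim, true_and, ne_eq, not_true_eq_false, false_and, or_false, Set.mem_ofPred_eq,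
      forbidden, List.not_mem_nil, Set.iUnion_of_empty, Set.iUnion_empty, Set.sdiff_empty]
    exact ⟨fun hB => ⟨hM _ hB, _, hB, rfl⟩, by rintro ⟨-, B, hB, rfl⟩; exact hB⟩
  · simp [trim, h]

variable [Fintype F]

lemma reachable_invariant {P : Set (Submodule F (Fin 4 → F))} (hP : IsSpread 2 P)
    {s : State F} (hs : Reachable P s) :
    s.family = remaining P s.chosen ∧ IsChoice P s.chosen := by
  have hcard : 1 < Fintype.card F := Fintype.one_lt_card
  induction hs with
  | refl =>
    refine ⟨?_, ⟨by simp [initial], by simp [initial], by simp [initial]⟩⟩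
    ext B
    simp only [initial, remaining, deleted_nil, Set.mem_image, Set.sdiff_empty, List.not_mem_nil,
      false_implies, implies_true, true_and, Set.mem_ofPred_eq]
    constructor
    · rintro ⟨W, hW, rfl⟩
      refine ⟨?_, W, hW, rfl⟩
      rw [ncard_points W (hP.finrank_eq W hW)]
      simp [Finset.sum_range_succ]
      omega
    · rintro ⟨-, W, hW, rfl⟩
      exact ⟨W, hW, rfl⟩
  | tail _ hround ih =>
    rename_i s _ _
    obtain ⟨hfam, hch⟩ := ih
    obtain ⟨A, hA, l, hl, hlA, p, hp, rfl⟩ := hround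
    have hAr := hA
    rw [hfam] at hAr
    obtain ⟨-, W, hW, hWU, rfl⟩ := hAr
    have hpl : plane p = W := plane_eq (hP.finrank_eq W hW) hl (fun a => (hlA a).1) hp
    have hM : ∀ B ∈ s.family \ {points W \ deleted s.chosen}, 3 ≤ B.ncard := by
      rintro B ⟨hB, -⟩
      rw [hfam] at hB
      exact hB.1
    refine ⟨?_, ?_⟩
    · dsimp only
      rw [trim_eq hM, hfam]
      ext B'
      simp only [remaining, deleted_append, Set.mem_ofPred_eq, Set.mem_sdiff,
        Set.mem_singleton_iff, ← Set.sdiff_sdiff]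
      refine and_congr_right fun h3 => ⟨?_, ?_⟩
      · rintro ⟨B, ⟨⟨-, W', hW', hW'U, rfl⟩, hne⟩, rfl⟩
        refine ⟨W', hW', ?_, rfl⟩
        intro p' hp'
        rcases List.mem_append.1 hp' with h | h
        · exact hW'U p' h
        · rw [List.mem_singleton.1 h, hpl]
          rintro rfl
          exact hne rfl
      · rintro ⟨W', hW', hW'U, rfl⟩
        refine ⟨_, ⟨⟨?_, W', hW', fun p' hp' => hW'U p' (List.mem_append_left _ hp'), rfl⟩, ?_⟩,
          rfl⟩
        · exact h3.trans (Set.ncard_le_ncard Set.sdiff_subset (Set.toFinite _))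
        · intro heq
          have hne : W ≠ W' := hpl ▸ hW'U p (by simp)
          have h0 := hlA 0
          rw [← heq] at h0
          exact Set.disjoint_left.1 (disjoint_points (hP.inter_eq_bot W hW W' hW' hne))
            (hlA 0).1 h0.1
    · refine ⟨?_, ?_, ?_⟩
      · intro p' hp'
        rcases List.mem_append.1 hp' with h | h
        · exact hch.mem p' h
        · rw [List.mem_singleton.1 h, hpl]
          exact hW
      · rw [List.map_append, List.map_singleton, List.nodup_append]
        refine ⟨hch.nodup, List.nodup_singleton _, ?_⟩
        intro W₁ h1 W₂ h2
        obtain ⟨p', hp', rfl⟩ := List.mem_map.1 h1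
        rw [List.mem_singleton.1 h2, hpl]
        exact hWU p' hp'
      · intro prev p' hpre a
        rcases List.prefix_concat_iff.1 hpre with h | h
        · obtain ⟨rfl, h2⟩ := List.append_inj' h rfl
          obtain rfl : p' = p := by simpa using h2
          rw [hp a]
          exact (hlA a).2
        · exact hch.avoid prev p' h a

lemma IsChoice.length_le {P : Set (Submodule F (Fin 4 → F))} (hP : IsSpread 2 P)
    {U : List ((Fin 4 → F) × (Fin 4 → F))} (hU : IsChoice P U) :
    U.length ≤ Fintype.card F ^ 2 + 1 := by
  classical
  rw [← hP.ncard_eq, ← List.length_map (f := plane), ← List.toFinset_card_of_nodup hU.nodup,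
    ← Set.ncard_coe_finset]
  refine Set.ncard_le_ncard (fun W hW => ?_) (Set.toFinite _)
  obtain ⟨p, hp, rfl⟩ := List.mem_map.1 (List.mem_toFinset.1 hW)
  exact hU.mem p hp

end Invariant

/-! ### The number of rounds -/

section Count

variable {F : Type*} [Field F]

lemma IsChoice.of_append {P : Set (Submodule F (Fin 4 → F))}
    {U U' : List ((Fin 4 → F) × (Fin 4 → F))} (h : IsChoice P (U ++ U')) : IsChoice P U where
  mem p hp := h.mem p (List.mem_append_left _ hp)
  nodup := by
    have := h.nodup
    rw [List.map_append] at this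
    exact this.of_append_left
  avoid prev p hpre := h.avoid prev p (hpre.trans (List.prefix_append _ _))

/-- No three chosen points from different rounds are collinear: the last one was not deleted. -/
lemma IsChoice.add_add_ne_zero {P : Set (Submodule F (Fin 4 → F))} (hP : IsSpread 2 P)
    {U : List ((Fin 4 → F) × (Fin 4 → F))} (hU : IsChoice P U) {i j k : Fin U.length}
    (hij : i ≠ j) (hik : i ≠ k) (hjk : j ≠ k) {a b c : Fin 3} {x y z : F} (hx : x ≠ 0)
    (hy : y ≠ 0) (hz : z ≠ 0) :
    x • triple (U.get i) a + y • triple (U.get j) b + z • triple (U.get k) c ≠ 0 := by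
  have key : ∀ {i j k : Fin U.length} {a b c : Fin 3} {x y z : F}, i < j → j < k → z ≠ 0 →
      x • triple (U.get i) a + y • triple (U.get j) b + z • triple (U.get k) c ≠ 0 := by
    intro i j k a b c x y z hij hjk hz h
    have htake : ∀ n : Fin U.length, U.take n ++ [U.get n] <+: U := fun n => by
      rw [List.get_eq_getElem, List.take_concat_get']
      exact List.take_prefix _ _
    refine hU.avoid (U.take k) (U.get k) (htake k) c ?_
    refine ⟨U.take j, U.get j, ?_, ?_⟩
    · rw [List.get_eq_getElem, List.take_concat_get']
      exact List.take_prefix_take_left (by omega)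
    · simp only [forbidden, Set.mem_iUnion]
      refine ⟨U.get i, ?_, b, a, span_singleton_mem_points ?_
        (triple_ne_zero (hP.finrank_eq _ (hU.mem _ (List.get_mem _ _))) c)⟩
      · exact List.mem_take_iff_getElem.2 ⟨i, by omega, rfl⟩
      · rw [Submodule.mem_span_pair]
        refine ⟨-(z⁻¹ * y), -(z⁻¹ * x), ?_⟩
        have h2 : triple (U.get k) c = z⁻¹ • z • triple (U.get k) c := by
          rw [smul_smul, inv_mul_cancel₀ hz, one_smul]
        rw [h2, eq_neg_of_add_eq_zero_right h]
        module
  intro h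
  rcases lt_or_gt_of_ne hij with h1 | h1 <;> rcases lt_or_gt_of_ne hik with h2 | h2 <;>
    rcases lt_or_gt_of_ne hjk with h3 | h3
  · exact key h1 h3 hz h
  · exact key h2 h3 hy (by rw [← h]; module)
  · omega
  · exact key h2 h1 hy (by rw [← h]; module)
  · exact key h1 h2 hz (by rw [← h]; module)
  · omega
  · exact key h3 h2 hx (by rw [← h]; module)
  · exact key h3 h1 hx (by rw [← h]; module)

variable [Fintype F]

/-- A line that joins points of two different members of a spread has `q - 1` further points. -/
lemma ncard_joining_line {P : Set (Submodule F (Fin 4 → F))} (hP : IsSpread 2 P)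
    {W W' : Submodule F (Fin 4 → F)} (hW : W ∈ P) (hW' : W' ∈ P) (hne : W ≠ W')
    {x y : Fin 4 → F} (hx : x ∈ W) (hy : y ∈ W') (hx0 : x ≠ 0) (hy0 : y ≠ 0) :
    (points (Submodule.span F {x, y}) \
      {Submodule.span F {x}, Submodule.span F {y}}).ncard = Fintype.card F - 1 := by
  have hxp := span_singleton_mem_points (F := F) hx hx0
  have hyp := span_singleton_mem_points (F := F) hy hy0
  have hxy : Submodule.span F {x} ≠ Submodule.span F {y} := fun h =>
    Set.disjoint_left.1 (disjoint_points (hP.inter_eq_bot W hW W' hW' hne)) hxp (h ▸ hyp)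
  have hdim : Module.finrank F (Submodule.span F {x, y}) = 2 := by
    have h := Submodule.finrank_sup_add_finrank_inf_eq (Submodule.span F {x})
      (Submodule.span F {y})
    have hbot : Submodule.span F {x} ⊓ Submodule.span F {y} = ⊥ := by
      rw [← le_bot_iff, ← hP.inter_eq_bot W hW W' hW' hne]
      exact inf_le_inf hxp.1 hyp.1
    rw [hbot, finrank_bot, hxp.2, hyp.2, ← Submodule.span_insert] at h
    exact h
  rw [Set.ncard_sdiff, ncard_points _ hdim, Set.ncard_pair hxy]
  · simp [Finset.sum_range_succ]
    omega
  · rintro l (rfl | rfl)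
    · exact span_singleton_mem_points (Submodule.subset_span (by simp)) hx0
    · exact span_singleton_mem_points (Submodule.subset_span (by simp)) hy0

/-- In each round the nine lines to an earlier pair delete at most `9 (q - 1)` points from a set
`O` of points that avoids the chosen ones. -/
lemma ncard_forbidden_inter_le {P : Set (Submodule F (Fin 4 → F))} (hP : IsSpread 2 P)
    {O : Set (Submodule F (Fin 4 → F))} {p : (Fin 4 → F) × (Fin 4 → F)} (hp : plane p ∈ P)
    (hpO : ∀ a, Submodule.span F {triple p a} ∉ O) (prev : List ((Fin 4 → F) × (Fin 4 → F)))
    (hprev : ∀ p' ∈ prev, plane p' ∈ P ∧ plane p ≠ plane p' ∧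
      ∀ a, Submodule.span F {triple p' a} ∉ O) :
    (forbidden prev p ∩ O).ncard ≤ 9 * (Fintype.card F - 1) * prev.length := by
  induction prev with
  | nil => simp [forbidden]
  | cons p' prev ih =>
    have ih := ih fun p'' h => hprev p'' (List.mem_cons_of_mem _ h)
    obtain ⟨hp', hne, hp'O⟩ := hprev p' List.mem_cons_self
    have hsub : forbidden (p' :: prev) p ∩ O ⊆
        (⋃ c : Fin 3 × Fin 3, points (Submodule.span F {triple p c.1, triple p' c.2}) \
          {Submodule.span F {triple p c.1}, Submodule.span F {triple p' c.2}}) ∪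
        (forbidden prev p ∩ O) := by
      rintro l ⟨hl, hlO⟩
      simp only [forbidden, Set.mem_iUnion, List.mem_cons] at hl
      obtain ⟨p'', h, a, b, hl⟩ := hl
      rcases h with rfl | h
      · refine Or.inl (Set.mem_iUnion.2 ⟨(a, b), hl, ?_⟩)
        rintro (rfl | rfl)
        · exact hpO a hlO
        · exact hp'O b hlO
      · refine Or.inr ⟨?_, hlO⟩
        simp only [forbidden, Set.mem_iUnion]
        exact ⟨p'', h, a, b, hl⟩
    have h9 := Set.ncard_iUnion_le_of_fintype fun c : Fin 3 × Fin 3 =>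
      points (Submodule.span F {triple p c.1, triple p' c.2}) \
        {Submodule.span F {triple p c.1}, Submodule.span F {triple p' c.2}}
    simp only [ncard_joining_line hP hp hp' hne (triple_mem_plane p _) (triple_mem_plane p' _)
      (triple_ne_zero (hP.finrank_eq _ hp) _) (triple_ne_zero (hP.finrank_eq _ hp') _),
      Finset.sum_const, Finset.card_univ, Fintype.card_prod, Fintype.card_fin, smul_eq_mul] at h9
    have h1 := Set.ncard_le_ncard hsub (Set.toFinite _)
    refine h1.trans ((Set.ncard_union_le _ _).trans ?_)
    rw [List.length_cons, mul_add, mul_one]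
    omega

lemma ncard_deleted_inter_le {P : Set (Submodule F (Fin 4 → F))} (hP : IsSpread 2 P)
    {O : Set (Submodule F (Fin 4 → F))} (U : List ((Fin 4 → F) × (Fin 4 → F)))
    (hU : IsChoice P U) (hO : ∀ p ∈ U, ∀ a, Submodule.span F {triple p a} ∉ O) :
    2 * (deleted U ∩ O).ncard + 9 * (Fintype.card F - 1) * U.length ≤
      9 * (Fintype.card F - 1) * U.length ^ 2 := by
  induction U using List.reverseRecOn with
  | nil => simp [deleted_nil]
  | append_singleton U p ih =>
    have ih := ih hU.of_append fun p' h => hO p' (List.mem_append_left _ h)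
    have hnd := hU.nodup
    rw [List.map_append, List.map_singleton, List.nodup_append] at hnd
    have hf := ncard_forbidden_inter_le hP (hU.mem p (by simp)) (hO p (by simp)) U
      fun p' h => ⟨hU.mem p' (List.mem_append_left _ h),
        (hnd.2.2 _ (List.mem_map_of_mem h) _ (by simp)).symm, hO p' (List.mem_append_left _ h)⟩
    rw [deleted_append, Set.union_inter_distrib_right, List.length_append, List.length_singleton]
    have := Set.ncard_union_le (deleted U ∩ O) (forbidden U p ∩ O)
    nlinarith

/-- If no member of the spread is left with three points, then each member that was not used has
lost at least `q - 1` points. -/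
theorem IsChoice.length_bound {P : Set (Submodule F (Fin 4 → F))} (hP : IsSpread 2 P)
    {U : List ((Fin 4 → F) × (Fin 4 → F))} (hU : IsChoice P U) (hrem : remaining P U = ∅) :
    2 * Fintype.card F ^ 2 + 2 + 7 * U.length ≤ 9 * U.length ^ 2 := by
  classical
  have hq : 1 < Fintype.card F := Fintype.one_lt_card
  let Q : Finset (Submodule F (Fin 4 → F)) :=
    (Set.toFinite P).toFinset \ (U.map plane).toFinset
  have hQ : ∀ W, W ∈ Q ↔ W ∈ P ∧ ∀ p ∈ U, plane p ≠ W := by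
    intro W
    simp [Q]
  have hQcard : Q.card = Fintype.card F ^ 2 + 1 - U.length := by
    rw [Finset.card_sdiff_of_subset, ← Set.ncard_eq_toFinset_card, hP.ncard_eq,
      List.toFinset_card_of_nodup hU.nodup, List.length_map]
    intro W hW
    obtain ⟨p, hp, rfl⟩ := List.mem_map.1 (List.mem_toFinset.1 hW)
    simpa using hU.mem p hp
  have hdisj : (Q : Set (Submodule F (Fin 4 → F))).PairwiseDisjoint points :=
    fun W hW W' hW' hne => disjoint_points
      (hP.inter_eq_bot W ((hQ W).1 hW).1 W' ((hQ W').1 hW').1 hne)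
  have hlow : ∀ W ∈ Q, Fintype.card F - 1 ≤ (deleted U ∩ points W).ncard := by
    intro W hW
    have h2 : (points W \ deleted U).ncard < 3 := by
      by_contra! h3
      have : points W \ deleted U ∈ remaining P U := ⟨h3, W, ((hQ W).1 hW).1, ((hQ W).1 hW).2, rfl⟩
      rw [hrem] at this
      exact this
    have h1 := Set.ncard_inter_add_ncard_sdiff_eq_ncard (points W) (deleted U) (Set.toFinite _)
    rw [ncard_points W (hP.finrank_eq W ((hQ W).1 hW).1)] at h1
    simp only [Finset.sum_range_succ, Finset.sum_range_zero, pow_zero, pow_one, zero_add] at h1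
    rw [Set.inter_comm]
    omega
  have hsum : Q.card * (Fintype.card F - 1) ≤ (deleted U ∩ ⋃ W ∈ Q, points W).ncard := by
    rw [Set.inter_iUnion₂, ncard_biUnion Q fun W => deleted U ∩ points W]
    · simpa using Finset.card_nsmul_le_sum Q _ _ hlow
    · exact fun W hW W' hW' hne => (hdisj hW hW' hne).mono Set.inter_subset_right
        Set.inter_subset_right
  have hup := ncard_deleted_inter_le hP (O := ⋃ W ∈ Q, points W) U hU (by
    intro p hp a ha
    simp only [Set.mem_iUnion] at ha
    obtain ⟨W, hW, ha⟩ := ha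
    have hpP := hU.mem p hp
    exact Set.disjoint_left.1
      (disjoint_points (hP.inter_eq_bot _ hpP W ((hQ W).1 hW).1 (((hQ W).1 hW).2 p hp)))
      (span_singleton_mem_points (triple_mem_plane p a)
        (triple_ne_zero (hP.finrank_eq _ hpP) a)) ha)
  have hlen := hU.length_le hP
  rw [hQcard] at hsum
  obtain ⟨r, hr⟩ : ∃ r, Fintype.card F = r + 2 := ⟨Fintype.card F - 2, by omega⟩
  obtain ⟨t, ht⟩ : ∃ t, Fintype.card F ^ 2 + 1 = U.length + t := ⟨_, (Nat.add_sub_of_le hlen).symm⟩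
  rw [ht, Nat.add_sub_cancel_left] at hsum
  have hr1 : Fintype.card F - 1 = r + 1 := by omega
  rw [hr1] at hsum hup
  have : (r + 1) * (2 * t + 9 * U.length) ≤ (r + 1) * (9 * U.length ^ 2) := by nlinarith
  have := Nat.le_of_mul_le_mul_left this (by omega)
  omega

end Count

/-! ### The code of a list of pairs -/

section Code

variable {F : Type*} [Field F] {U : List ((Fin 4 → F) × (Fin 4 → F))}

/-- The contribution of the `i`-th group of coordinates of `c` to the last four parity checks. -/
def block (U : List ((Fin 4 → F) × (Fin 4 → F))) (c : Fin U.length × Fin 3 → F)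
    (i : Fin U.length) : Fin 4 → F :=
  c (i, 0) • (U.get i).1 + c (i, 1) • (U.get i).2

lemma parityCheck_mulVec (c : Fin U.length × Fin 3 → F) :
    (parityCheck U).mulVec c =
      Sum.elim (fun i => c (i, 0) + c (i, 1) + c (i, 2)) (∑ i, block U c i) := by
  rw [parityCheck, Matrix.fromRows_mulVec]
  congr 1
  · funext i
    simp [Matrix.mulVec, dotProduct, Fintype.sum_prod_type, Fin.sum_univ_three,
      Finset.sum_add_distrib]
  · funext m
    simp [Matrix.mulVec, dotProduct, Fintype.sum_prod_type, Fin.sum_univ_three, block, mul_comm]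

lemma mem_code {c : Fin U.length × Fin 3 → F} :
    c ∈ code U ↔ (∀ i, c (i, 0) + c (i, 1) + c (i, 2) = 0) ∧ ∑ i, block U c i = 0 := by
  rw [code, LinearMap.mem_ker, Matrix.mulVecLin_apply, parityCheck_mulVec, ← Sum.elim_zero_zero,
    Sum.elim_eq_iff]
  simp [funext_iff]

lemma block_mem_plane (c : Fin U.length × Fin 3 → F) (i : Fin U.length) :
    block U c i ∈ plane (U.get i) :=
  add_mem (Submodule.smul_mem _ _ (triple_mem_plane _ 1))
    (Submodule.smul_mem _ _ (triple_mem_plane _ 2))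

/-- The word with the given first two coordinates in each group, and with the given group sums. -/
def word (s x y : Fin U.length → F) : Fin U.length × Fin 3 → F :=
  fun p => ![x p.1, y p.1, s p.1 - x p.1 - y p.1] p.2

lemma parityCheck_mulVec_word (s x y : Fin U.length → F) :
    (parityCheck U).mulVec (word s x y) =
      Sum.elim s (∑ i, (x i • (U.get i).1 + y i • (U.get i).2)) := by
  rw [parityCheck_mulVec]
  congr 1
  funext i
  simp [word]

/-! ### Repair groups -/

/-- The coordinates of the `i`-th column triple. -/
def group (n : ℕ) (i : Fin n) : Finset (Fin n × Fin 3) :=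
  {(i, 0), (i, 1), (i, 2)}

lemma mem_group {n : ℕ} {i : Fin n} {x : Fin n × Fin 3} : x ∈ group n i ↔ x.1 = i := by
  obtain ⟨j, a⟩ := x
  fin_cases a <;> simp [group]

lemma self_mem_group {n : ℕ} (i : Fin n) (a : Fin 3) : (i, a) ∈ group n i :=
  mem_group.2 rfl

lemma isRepairSet_group (i : Fin U.length) (a : Fin 3) :
    IsRepairSet (code U) (i, a) ((group U.length i).erase (i, a)) := by
  refine ⟨Finset.notMem_erase _ _, fun _ => -1, fun _ _ => neg_ne_zero.2 one_ne_zero,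
    fun c hc => ?_⟩
  have hsum : ∑ x ∈ group U.length i, c x = 0 := by
    rw [← (mem_code.1 hc).1 i]
    simp [group, add_assoc]
  rw [← Finset.add_sum_erase _ _ (self_mem_group i a)] at hsum
  simp only [neg_mul, one_mul, Finset.sum_neg_distrib]
  exact eq_neg_of_add_eq_zero_left hsum

lemma card_group {n : ℕ} (i : Fin n) : (group n i).card = 3 := by
  simp [group]

lemma card_group_erase {n : ℕ} (i : Fin n) (a : Fin 3) : ((group n i).erase (i, a)).card = 2 := by
  rw [Finset.card_erase_of_mem (self_mem_group i a), card_group]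

lemma hasDisjointRepairGroups_code : HasDisjointRepairGroups (code U) 2 := by
  refine ⟨Finpartition.ofExistsUnique (Finset.univ.image (group U.length))
    (fun _ _ => Finset.subset_univ _) (fun x _ => ?_) ?_, fun G hG => ?_⟩
  · refine ⟨group _ x.1, ⟨Finset.mem_image_of_mem _ (Finset.mem_univ _), mem_group.2 rfl⟩, ?_⟩
    rintro G ⟨hG, hx⟩
    obtain ⟨i, -, rfl⟩ := Finset.mem_image.1 hG
    rw [mem_group.1 hx]
  · intro h
    obtain ⟨i, -, hi⟩ := Finset.mem_image.1 h
    have := card_group i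
    rw [hi] at this
    simp at this
  · obtain ⟨i, -, rfl⟩ := Finset.mem_image.1 hG
    exact ⟨⟨(i, 0), _, isRepairSet_group i 0, (card_group_erase i 0).le,
      (Finset.insert_erase (self_mem_group i 0)).symm⟩, card_group i⟩

/-! ### Dimension and minimum distance -/

variable {P : Set (Submodule F (Fin 4 → F))}

lemma IsChoice.plane_inf (hP : IsSpread 2 P) (hU : IsChoice P U) {i j : Fin U.length}
    (hij : i ≠ j) : plane (U.get i) ⊓ plane (U.get j) = ⊥ := by
  refine hP.inter_eq_bot _ (hU.mem _ (List.get_mem _ _)) _ (hU.mem _ (List.get_mem _ _)) ?_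
  intro h
  refine hij (Fin.ext ?_)
  have := (List.Nodup.getElem_inj_iff hU.nodup (i := i) (j := j) (hi := by simp)
    (hj := by simp)).1 (by simpa using h)
  exact this

lemma IsChoice.eq_zero_of_mem (hP : IsSpread 2 P) (hU : IsChoice P U) {i j : Fin U.length}
    (hij : i ≠ j) {v : Fin 4 → F} (hi : v ∈ plane (U.get i)) (hj : v ∈ plane (U.get j)) :
    v = 0 := by
  have : v ∈ plane (U.get i) ⊓ plane (U.get j) := ⟨hi, hj⟩
  rwa [hU.plane_inf hP hij, Submodule.mem_bot] at this

lemma IsChoice.finrank_plane (hP : IsSpread 2 P) (hU : IsChoice P U) (i : Fin U.length) :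
    Module.finrank F (plane (U.get i)) = 2 :=
  hP.finrank_eq _ (hU.mem _ (List.get_mem _ _))

/-- Two members of a spread span the space. -/
lemma IsChoice.exists_combination (hP : IsSpread 2 P) (hU : IsChoice P U) {i j : Fin U.length}
    (hij : i ≠ j) (v : Fin 4 → F) : ∃ a b a' b' : F,
    (a • (U.get i).1 + b • (U.get i).2) + (a' • (U.get j).1 + b' • (U.get j).2) = v := by
  have htop : plane (U.get i) ⊔ plane (U.get j) = ⊤ := by
    refine Submodule.eq_top_of_finrank_eq ?_
    have h := Submodule.finrank_sup_add_finrank_inf_eq (plane (U.get i)) (plane (U.get j))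
    rw [hU.plane_inf hP hij, finrank_bot, hU.finrank_plane hP, hU.finrank_plane hP] at h
    rw [Module.finrank_fintype_fun_eq_card, Fintype.card_fin]
    exact h
  have hv : v ∈ plane (U.get i) ⊔ plane (U.get j) := htop ▸ Submodule.mem_top
  obtain ⟨x, hx, y, hy, rfl⟩ := Submodule.mem_sup.1 hv
  obtain ⟨a, b, rfl⟩ := Submodule.mem_span_pair.1 hx
  obtain ⟨a', b', rfl⟩ := Submodule.mem_span_pair.1 hy
  exact ⟨a, b, a', b', rfl⟩

lemma IsChoice.finrank_code (hP : IsSpread 2 P) (hU : IsChoice P U) (hL : 2 ≤ U.length) :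
    Module.finrank F (code U) = 2 * U.length - 4 := by
  have hrange : LinearMap.range (parityCheck U).mulVecLin = ⊤ := by
    rw [LinearMap.range_eq_top]
    intro t
    have h01 : (⟨0, by omega⟩ : Fin U.length) ≠ ⟨1, by omega⟩ := by simp
    obtain ⟨a, b, a', b', h⟩ := hU.exists_combination hP h01 (t ∘ Sum.inr)
    refine ⟨word (t ∘ Sum.inl) (Pi.single ⟨0, by omega⟩ a + Pi.single ⟨1, by omega⟩ a')
      (Pi.single ⟨0, by omega⟩ b + Pi.single ⟨1, by omega⟩ b'), ?_⟩
    rw [Matrix.mulVecLin_apply, parityCheck_mulVec_word]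
    have : ∑ i,
        ((Pi.single ⟨0, by omega⟩ a + Pi.single ⟨1, by omega⟩ a' : Fin U.length → F) i •
          (U.get i).1 +
        (Pi.single ⟨0, by omega⟩ b + Pi.single ⟨1, by omega⟩ b' : Fin U.length → F) i •
          (U.get i).2) = t ∘ Sum.inr := by
      rw [← h]
      simp only [Pi.add_apply, add_smul, Finset.sum_add_distrib, Pi.single_apply, ite_smul,
        zero_smul, Finset.sum_ite_eq', Finset.mem_univ, if_true]
      abel
    rw [this, Sum.elim_comp_inl_inr]
  have h := LinearMap.finrank_range_add_finrank_ker (parityCheck U).mulVecLin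
  rw [hrange, finrank_top, Module.finrank_fintype_fun_eq_card,
    Module.finrank_fintype_fun_eq_card] at h
  simp only [Fintype.card_sum, Fintype.card_prod, Fintype.card_fin] at h
  rw [code]
  omega

variable [DecidableEq F]

/-- The weight of the `i`-th group of coordinates of `c`. -/
def groupWeight (c : Fin U.length × Fin 3 → F) (i : Fin U.length) : ℕ :=
  (Finset.univ.filter fun a => c (i, a) ≠ 0).card

lemma hammingNorm_eq_sum (c : Fin U.length × Fin 3 → F) :
    hammingNorm c = ∑ i, groupWeight c i := by
  simp only [hammingNorm, groupWeight, Finset.card_filter, Fintype.sum_prod_type]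

/-- A group of weight two contributes a multiple of `u₀`, `u₁` or `u₂`. -/
lemma groupWeight_cases {c : Fin U.length × Fin 3 → F} {i : Fin U.length}
    (hc : c (i, 0) + c (i, 1) + c (i, 2) = 0) (hb : block U c i ≠ 0) :
    3 ≤ groupWeight c i ∨ 2 ≤ groupWeight c i ∧
      ∃ a, ∃ t : F, t ≠ 0 ∧ block U c i = t • triple (U.get i) a := by
  have hw : groupWeight c i = (if c (i, 0) ≠ 0 then 1 else 0) + (if c (i, 1) ≠ 0 then 1 else 0)
      + (if c (i, 2) ≠ 0 then 1 else 0) := by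
    rw [groupWeight, Finset.card_filter, Fin.sum_univ_three]
  rw [hw]
  by_cases h0 : c (i, 0) = 0
  · have h1 : c (i, 1) ≠ 0 := fun h1 => hb (by simp [block, h0, h1])
    have h2 : c (i, 2) ≠ 0 := fun h2 => h1 (by simpa [h0, h2] using hc)
    exact Or.inr ⟨by simp [h0, h1, h2], 2, c (i, 1), h1, by simp [block, h0, triple]⟩
  by_cases h1 : c (i, 1) = 0
  · have h2 : c (i, 2) ≠ 0 := fun h2 => h0 (by simpa [h1, h2] using hc)
    exact Or.inr ⟨by simp [h0, h1, h2], 1, c (i, 0), h0, by simp [block, h1, triple]⟩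
  by_cases h2 : c (i, 2) = 0
  · refine Or.inr ⟨by simp [h0, h1, h2], 0, c (i, 0), h0, ?_⟩
    have : c (i, 1) = -c (i, 0) := by
      rw [h2, add_zero] at hc
      exact eq_neg_of_add_eq_zero_right hc
    simp [block, this, triple, sub_eq_add_neg]
  · exact Or.inl (by simp [h0, h1, h2])

/-- The nonzero blocks of a codeword sum to zero. There are at least three, as two members of a
spread are independent, and each has weight two or three; three blocks of weight two would give
three collinear chosen points. -/
lemma IsChoice.seven_le_hammingNorm (hP : IsSpread 2 P) (hU : IsChoice P U)
    {c : Fin U.length × Fin 3 → F} (hc : c ∈ code U) (hc0 : c ≠ 0) : 7 ≤ hammingNorm c := by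
  classical
  obtain ⟨hloc, hsum⟩ := mem_code.1 hc
  let I : Finset (Fin U.length) := Finset.univ.filter fun i => block U c i ≠ 0
  have hI : ∀ i ∈ I, block U c i ≠ 0 := fun i hi => (Finset.mem_filter.1 hi).2
  have hsumI : ∑ i ∈ I, block U c i = 0 := by
    rw [← hsum, Finset.sum_filter_ne_zero]
  have hle : ∑ i ∈ I, groupWeight c i ≤ hammingNorm c := by
    rw [hammingNorm_eq_sum]
    exact Finset.sum_le_sum_of_subset (Finset.subset_univ _)
  have hcases := fun i (hi : i ∈ I) => groupWeight_cases (hloc i) (hI i hi)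
  have h2 : ∀ i ∈ I, 2 ≤ groupWeight c i := fun i hi => by
    rcases hcases i hi with h | h
    · omega
    · exact h.1
  have h2I : 2 * I.card ≤ ∑ i ∈ I, groupWeight c i := by
    have := Finset.card_nsmul_le_sum I (fun i => groupWeight c i) 2 h2
    rwa [smul_eq_mul, mul_comm] at this
  by_contra! hlt
  have hcard : I.card ≤ 3 := by omega
  interval_cases hn : I.card
  · rw [Finset.card_eq_zero] at hn
    refine hc0 (funext fun ⟨i, a⟩ => ?_)
    have hb : block U c i = 0 := by
      by_contra hb
      have : i ∈ I := Finset.mem_filter.2 ⟨Finset.mem_univ _, hb⟩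
      simp [hn] at this
    obtain ⟨h0, h1⟩ := eq_zero_of_smul_add_smul_eq_zero (hU.finrank_plane hP i) hb
    have hi := hloc i
    rw [h0, h1, zero_add, zero_add] at hi
    fin_cases a
    exacts [h0, h1, hi]
  · obtain ⟨i, hi⟩ := Finset.card_eq_one.1 hn
    rw [hi, Finset.sum_singleton] at hsumI
    exact hI i (by rw [hi]; simp) hsumI
  · obtain ⟨i, j, hij, hIe⟩ := Finset.card_eq_two.1 hn
    rw [hIe, Finset.sum_pair hij] at hsumI
    refine hI i (by rw [hIe]; simp) (hU.eq_zero_of_mem hP hij (block_mem_plane c i) ?_)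
    rw [eq_neg_of_add_eq_zero_left hsumI]
    exact neg_mem (block_mem_plane c j)
  · obtain ⟨i, j, k, hij, hik, hjk, hIe⟩ := Finset.card_eq_three.1 hn
    have hiI : i ∈ I := by rw [hIe]; simp
    have hjI : j ∈ I := by rw [hIe]; simp
    have hkI : k ∈ I := by rw [hIe]; simp
    have hw : ∑ l ∈ I, groupWeight c l = groupWeight c i + groupWeight c j + groupWeight c k := by
      rw [hIe, Finset.sum_insert (by simp [hij, hik]), Finset.sum_pair hjk, add_assoc]
    have hs : block U c i + block U c j + block U c k = 0 := by
      rw [← hsumI, hIe, Finset.sum_insert (by simp [hij, hik]), Finset.sum_pair hjk, add_assoc]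
    have := h2 i hiI
    have := h2 j hjI
    have := h2 k hkI
    rcases hcases i hiI with h | ⟨-, a, x, hx, hbi⟩
    · omega
    rcases hcases j hjI with h | ⟨-, b, y, hy, hbj⟩
    · omega
    rcases hcases k hkI with h | ⟨-, d, z, hz, hbk⟩
    · omega
    rw [hbi, hbj, hbk] at hs
    exact hU.add_add_ne_zero hP hij hik hjk hx hy hz hs

/-- Three blocks, one of them of weight two, make up a codeword. -/
lemma IsChoice.exists_hammingNorm_le_eight (hP : IsSpread 2 P) (hU : IsChoice P U)
    (hL : 3 ≤ U.length) : ∃ c ∈ code U, c ≠ 0 ∧ hammingNorm c ≤ 8 := by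
  obtain ⟨i₀, h0⟩ : ∃ i : Fin U.length, i = ⟨0, by omega⟩ := ⟨_, rfl⟩
  obtain ⟨i₁, h1⟩ : ∃ i : Fin U.length, i = ⟨1, by omega⟩ := ⟨_, rfl⟩
  obtain ⟨i₂, h2⟩ : ∃ i : Fin U.length, i = ⟨2, by omega⟩ := ⟨_, rfl⟩
  have h01 : i₀ ≠ i₁ := by simp [h0, h1]
  have h02 : i₂ ≠ i₀ := by simp [h0, h2]
  have h12 : i₂ ≠ i₁ := by simp [h1, h2]
  obtain ⟨a, b, a', b', h⟩ := hU.exists_combination hP h01 ((U.get i₂).2 - (U.get i₂).1)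
  let x : Fin U.length → F := Pi.single i₀ a + Pi.single i₁ a' + Pi.single i₂ 1
  let y : Fin U.length → F := Pi.single i₀ b + Pi.single i₁ b' + Pi.single i₂ (-1)
  refine ⟨word 0 x y, ?_, ?_, ?_⟩
  · rw [code, LinearMap.mem_ker, Matrix.mulVecLin_apply, parityCheck_mulVec_word,
      ← Sum.elim_zero_zero]
    congr 1
    simp only [x, y, Pi.add_apply, add_smul, Finset.sum_add_distrib, Pi.single_apply, ite_smul,
      zero_smul, Finset.sum_ite_eq', Finset.mem_univ, if_true, one_smul, neg_smul]
    linear_combination (exp := 1) h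
  · intro h0
    have := congrFun h0 (i₂, 0)
    simp [word, x, h02, h12] at this
  · have hsub : (Finset.univ.filter fun p => word 0 x y p ≠ 0) ⊆
        group U.length i₀ ∪ (group U.length i₁ ∪ (group U.length i₂).erase (i₂, 2)) := by
      intro p hp
      have hp := (Finset.mem_filter.1 hp).2
      simp only [Finset.mem_union, Finset.mem_erase, mem_group]
      by_contra! hcon
      obtain ⟨hp0, hp1, hp2⟩ := hcon
      obtain ⟨i, e⟩ := p
      by_cases hi : i = i₂
      · obtain rfl : e = 2 := by
          by_contra he
          exact hp2 (by simp [he]) hi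
        subst hi
        apply hp
        simp [word, x, y, h02, h12]
      · apply hp
        fin_cases e <;> simp_all [word, x, y]
    refine (Finset.card_le_card hsub).trans ?_
    have e1 := Finset.card_union_le (group U.length i₀)
      (group U.length i₁ ∪ (group U.length i₂).erase (i₂, 2))
    have e2 := Finset.card_union_le (group U.length i₁) ((group U.length i₂).erase (i₂, 2))
    rw [card_group, card_group_erase] at *
    omega

/-- Projection from a chosen point maps the chosen points of the other rounds to different
points, and none of them to that of the own spread member. -/
lemma IsChoice.length_upper [Fintype F] (hP : IsSpread 2 P) (hU : IsChoice P U)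
    (hL : 0 < U.length) : 3 * U.length ≤ Fintype.card F ^ 2 + Fintype.card F + 3 := by
  obtain ⟨i₀, -⟩ : ∃ i : Fin U.length, i = ⟨0, hL⟩ := ⟨_, rfl⟩
  have hmem : ∀ i a (t : F), t • triple (U.get i) a ∈ plane (U.get i) := fun i a t =>
    Submodule.smul_mem _ _ (triple_mem_plane _ a)
  have hne : ∀ i a (t : Fˣ), (t : F) • triple (U.get i) a ≠ 0 := fun i a t =>
    smul_ne_zero t.ne_zero (triple_ne_zero (hU.finrank_plane hP i) a)
  let f : F × (F ⊕ (Fˣ × {i // i ≠ i₀} × Fin 3)) → Fin 4 → F := fun p =>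
    p.1 • triple (U.get i₀) 0 + p.2.elim (fun t => t • triple (U.get i₀) 1)
      fun r => (r.1 : F) • triple (U.get r.2.1) r.2.2
  have hmix : ∀ (x x' t : F) (r : Fˣ × {i // i ≠ i₀} × Fin 3),
      f (x, Sum.inl t) ≠ f (x', Sum.inr r) := by
    rintro x x' t ⟨s, ⟨i, hi⟩, a⟩ h
    refine hne i a s (hU.eq_zero_of_mem hP hi (hmem _ _ _) ?_)
    have : (s : F) • triple (U.get i) a
        = (x - x') • triple (U.get i₀) 0 + t • triple (U.get i₀) 1 := by
      simp only [f, Sum.elim_inl, Sum.elim_inr] at h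
      rw [sub_smul, sub_add_eq_add_sub, h, add_sub_cancel_left]
    rw [this]
    exact add_mem (hmem _ _ _) (hmem _ _ _)
  have hf : Function.Injective f := by
    rintro ⟨x, t | ⟨t, ⟨i, hi⟩, a⟩⟩ ⟨x', t' | ⟨t', ⟨j, hj⟩, b⟩⟩ h
    · have h' : (x - x') • triple (U.get i₀) 0 + (t - t') • triple (U.get i₀) 1 = 0 := by
        simp only [f, Sum.elim_inl] at h
        rw [sub_smul, sub_smul, sub_add_sub_comm, h, sub_self]
      obtain ⟨h1, h2⟩ := triple_independent (hU.finrank_plane hP i₀) (by decide) h'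
      rw [sub_eq_zero.1 h1, sub_eq_zero.1 h2]
    · exact absurd h (hmix _ _ _ _)
    · exact absurd h.symm (hmix _ _ _ _)
    · simp only [f, Sum.elim_inr] at h
      have h' : (x - x') • triple (U.get i₀) 0 + (t : F) • triple (U.get i) a
          + (-t' : F) • triple (U.get j) b = 0 := by
        rw [sub_smul, sub_add_eq_add_sub, h, neg_smul]
        abel
      by_cases hij : i = j
      · subst hij
        have hd : (t : F) • triple (U.get i) a + (-t' : F) • triple (U.get i) b = 0 := by
          refine hU.eq_zero_of_mem hP hi (add_mem (hmem _ _ _) (hmem _ _ _)) ?_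
          rw [add_assoc] at h'
          rw [eq_neg_of_add_eq_zero_right h']
          exact neg_mem (hmem _ _ _)
        have hab : a = b := by
          by_contra hab
          exact t.ne_zero (triple_independent (hU.finrank_plane hP i) hab hd).1
        subst hab
        rw [add_assoc, hd, add_zero] at h'
        have hx := (smul_eq_zero.1 h').resolve_right
          (triple_ne_zero (hU.finrank_plane hP i₀) 0)
        rw [← add_smul] at hd
        have ht := (smul_eq_zero.1 hd).resolve_right
          (triple_ne_zero (hU.finrank_plane hP i) a)
        rw [← sub_eq_add_neg] at ht
        obtain rfl : t = t' := Units.ext (sub_eq_zero.1 ht)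
        rw [sub_eq_zero.1 hx]
      · exfalso
        by_cases hx : x - x' = 0
        · rw [hx, zero_smul, zero_add] at h'
          refine hne i a t (hU.eq_zero_of_mem hP hij (hmem _ _ _) ?_)
          rw [eq_neg_of_add_eq_zero_left h']
          exact neg_mem (hmem _ _ _)
        · exact hU.add_add_ne_zero hP (Ne.symm hi) (Ne.symm hj) hij hx t.ne_zero
            (neg_ne_zero.2 t'.ne_zero) h'
  have hcard := Fintype.card_le_of_injective f hf
  have hq : 1 < Fintype.card F := Fintype.one_lt_card
  rw [Fintype.card_prod, Fintype.card_sum, Fintype.card_prod, Fintype.card_prod,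
    Fintype.card_units, Fintype.card_subtype_compl, Fintype.card_fin, Fintype.card_subtype_eq,
    Fintype.card_fin, Fintype.card_fun, Fintype.card_fin] at hcard
  obtain ⟨r, hr⟩ : ∃ r, Fintype.card F = r + 2 := ⟨Fintype.card F - 2, by omega⟩
  obtain ⟨M, hM⟩ : ∃ M, U.length = M + 1 := ⟨U.length - 1, by omega⟩
  rw [hM, Nat.add_sub_cancel, hr] at hcard
  rw [hr, hM]
  have h1 : r + 2 - 1 = r + 1 := by omega
  rw [h1] at hcard
  have h2 : (r + 2) * ((r + 1) * (M * 3)) ≤ (r + 2) * ((r + 1) * ((r + 2) ^ 2 + (r + 2))) := by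
    nlinarith
  have h3 := Nat.le_of_mul_le_mul_left (Nat.le_of_mul_le_mul_left h2 (by omega)) (by omega)
  omega

end Code

/-! ### Parameters -/

section Parameters

/-- The argument of the logarithm lies above `q ^ 3` if `3 L > q + 3` and is at most `q ^ 4` if
`3 L ≤ q ^ 2 + q + 3`. -/
lemma dimensionBound_eq {q L : ℕ} (hq : 2 ≤ q) (hL : 2 ≤ L) (hlow : q + 4 ≤ 3 * L)
    (hup : 3 * L ≤ q ^ 2 + q + 3) :
    ((2 * L - 4 : ℕ) : ℝ) = dimensionBound q (3 * L) 2 := by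
  have hq' : (2 : ℝ) ≤ q := by exact_mod_cast hq
  have hlow' : (q : ℝ) + 4 ≤ 3 * L := by exact_mod_cast hlow
  have hup' : (3 : ℝ) * L ≤ q ^ 2 + q + 3 := by exact_mod_cast hup
  have hpos : 0 < ((q : ℝ) - 1) * q := mul_pos (by linarith) (by linarith)
  have h1 : (q : ℝ) ^ 3 < q + (q - 1) * q * (3 * L - 2) := by
    have := mul_le_mul_of_nonneg_left (show (q : ℝ) + 2 ≤ 3 * L - 2 by linarith) hpos.le
    nlinarith
  have h2 : (q : ℝ) + (q - 1) * q * (3 * L - 2) ≤ q ^ 4 := by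
    have := mul_le_mul_of_nonneg_left
      (show (3 : ℝ) * L - 2 ≤ q ^ 2 + q + 1 by linarith) hpos.le
    nlinarith
  have hx : 0 < (q : ℝ) + (q - 1) * q * (3 * L - 2) := lt_trans (by positivity) h1
  have hceil : ⌈Real.logb q ((q : ℝ) + (q - 1) * q * (3 * L - 2))⌉ = 4 := by
    rw [Int.ceil_eq_iff]
    constructor
    · rw [Real.lt_logb_iff_rpow_lt (by linarith) hx]
      have : (((4 : ℤ) : ℝ) - 1) = ((3 : ℕ) : ℝ) := by norm_num
      rw [this, Real.rpow_natCast]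
      exact h1
    · rw [Real.logb_le_iff_le_rpow (by linarith) hx]
      have : ((4 : ℤ) : ℝ) = ((4 : ℕ) : ℝ) := by norm_num
      rw [this, Real.rpow_natCast]
      exact h2
  have harg : (q : ℝ) + (q - 1) * q * (((2 : ℕ) : ℝ) / 2 * ((3 * L : ℕ) : ℝ) - ((2 : ℕ) : ℝ))
      = q + (q - 1) * q * (3 * L - 2) := by
    push_cast
    ring
  rw [dimensionBound, harg, hceil, Nat.cast_sub (by omega)]
  push_cast
  ring

lemma almostOptimal_seven {L : ℕ} (hL : 2 ≤ L) :
    AlmostOptimal (3 * L) (2 * L - 4) 7 2 := by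
  have h : (((2 * L - 4 : ℕ) : ℚ) / (2 : ℕ)) = ((L - 2 : ℤ) : ℚ) := by
    rw [Nat.cast_sub (by omega)]
    push_cast
    ring
  rw [AlmostOptimal, h, Int.ceil_intCast, Nat.cast_sub (by omega)]
  push_cast
  ring

lemma exists_isMinDist {F : Type*} [Field F] [DecidableEq F] {ι : Type*} [Fintype ι]
    {C : Submodule F (ι → F)} (h : ∃ c ∈ C, c ≠ 0) : ∃ d, IsMinDist C d := by
  obtain ⟨c, hc, hc0⟩ := h
  exact ⟨_, Nat.sInf_mem ⟨_, c, hc, 0, C.zero_mem, hc0, rfl⟩, fun _ hw => Nat.sInf_le hw⟩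

end Parameters

end SpreadLRC

theorem theorem2 {F : Type*} [Field F] [Fintype F] [DecidableEq F] (hq : 4 ≤ Fintype.card F) :
    -- a spread with which the algorithm can be started exists
    (∃ P : Set (Submodule F (Fin 4 → F)),
      IsSpread 2 P ∧ P.ncard = Fintype.card F ^ 2 + 1) ∧
    ∀ P : Set (Submodule F (Fin 4 → F)), IsSpread 2 P →
      -- the choices asked for are always possible, and every run stops
      (∀ s : State F, Reachable P s →
        s.chosen.length ≤ Fintype.card F ^ 2 + 1 ∧
        ∀ A ∈ s.family, 3 ≤ A.ncard ∧
          ∀ l : Fin 3 → Submodule F (Fin 4 → F), Function.Injective l → (∀ a, l a ∈ A) →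
            ∃ p : (Fin 4 → F) × (Fin 4 → F), AreBases l p) ∧
      -- every output
      ∀ U : List ((Fin 4 → F) × (Fin 4 → F)), IsOutput P U →
        max ⌈Real.sqrt 2 / 3 * (Fintype.card F : ℝ)⌉₊ 3 ≤ U.length ∧
        HasDisjointRepairGroups (code U) 2 ∧
        ∃ d : ℕ, (d = 7 ∨ d = 8) ∧
          IsLRC (code U) (3 * U.length) (2 * U.length - 4) d 2 ∧
          ((2 * U.length - 4 : ℕ) : ℝ) = dimensionBound (Fintype.card F) (3 * U.length) 2 ∧
          (Fintype.card F + 4 < 3 * U.length →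
            d = 7 ∧
            AlmostOptimal (3 * U.length) (2 * U.length - 4) d 2 ∧
            ∀ (C : Submodule F (Fin (3 * U.length) → F)) (d' : ℕ),
              IsLRC C (3 * U.length) (2 * U.length - 4) d' 2 → d' ≤ d) := by
  obtain ⟨P₀, hP₀⟩ := exists_isSpread (F := F)
  refine ⟨⟨P₀, hP₀, hP₀.ncard_eq⟩, fun P hP => ⟨fun s hs => ?_, fun U hout => ?_⟩⟩
  · obtain ⟨hfam, hch⟩ := reachable_invariant hP hs
    refine ⟨hch.length_le hP, fun A hA => ?_⟩
    rw [hfam] at hA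
    obtain ⟨h3, W, hW, -, rfl⟩ := hA
    exact ⟨h3, fun l hl hlA => exists_areBases (hP.finrank_eq W hW) hl fun a => (hlA a).1⟩
  obtain ⟨hfam, hU⟩ := reachable_invariant hP hout
  have hbound := hU.length_bound hP hfam.symm
  dsimp only at hU hbound
  have h3 : 3 ≤ U.length := by
    by_contra! hlt
    interval_cases U.length <;> nlinarith
  have hlow : Fintype.card F + 4 ≤ 3 * U.length := by
    -- otherwise `q ≥ 3 L - 3`, and the bound gives `(9 L - 20) (L - 1) ≤ 0`
    by_contra! hlt
    nlinarith
  have hup := hU.length_upper hP (by omega)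
  obtain ⟨c, hc, hc0, hc8⟩ := hU.exists_hammingNorm_le_eight hP h3
  obtain ⟨d, hd⟩ := exists_isMinDist ⟨c, hc, hc0⟩
  have hd7 : 7 ≤ d := by
    obtain ⟨x, hx, y, hy, hxy, rfl⟩ := hd.1
    rw [hammingDist_eq_hammingNorm]
    exact hU.seven_le_hammingNorm hP (add_mem (neg_mem hx) hy)
      fun h => hxy (neg_add_eq_zero.1 h)
  have hd8 : d ≤ 8 :=
    (hd.2 ⟨c, hc, 0, Submodule.zero_mem _, hc0, rfl⟩).trans (by rwa [hammingDist_zero_right])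
  have hLRC : IsLRC (code U) (3 * U.length) (2 * U.length - 4) d 2 :=
    ⟨by simp [mul_comm], hU.finrank_code hP (by omega), hd, fun i =>
      ⟨_, isRepairSet_group i.1 i.2, (card_group_erase i.1 i.2).le⟩⟩
  refine ⟨max_le (Nat.ceil_le.2 ?_) h3, hasDisjointRepairGroups_code, d, by omega, hLRC,
    dimensionBound_eq (by omega) (by omega) hlow hup, fun hn => ?_⟩
  · have h2 : 2 * (Fintype.card F : ℝ) ^ 2 ≤ 9 * (U.length : ℝ) ^ 2 := by
      have : 2 * Fintype.card F ^ 2 ≤ 9 * U.length ^ 2 := by omega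
      exact_mod_cast this
    refine abs_le_of_sq_le_sq' ?_ (Nat.cast_nonneg _) |>.2
    rw [mul_pow, div_pow, Real.sq_sqrt (by norm_num)]
    linarith
  · obtain rfl : d = 7 := le_antisymm (hLRC.minDist_le_seven h3 hn) hd7
    exact ⟨rfl, almostOptimal_seven (by omega), fun C d' hC => hC.minDist_le_seven h3 hn⟩
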